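/- Let $p$ be an odd prime, let $\mathfrak o$ be a discrete valuation ring (for instance a compact one of characteristic zero) with maximal ideal $\mathfrak p$ and residue field $\mathfrak o/\mathfrak p=\mathbb F_q$, where $q=p^f$. Let $\mathfrak g$ be a finite $\mathfrak o$-Lie algebra of nilpotency class $2$, with centre $\mathfrak z$ and derived algebra $\mathfrak g'$, such that $\mathfrak g/\mathfrak z$ and $\mathfrak g'$ are annihilated by $\mathfrak p$. Let $G=\exp(\mathfrak g)$ be the $p$-group with underlying set $\mathfrak g$ and multiplication $u\star v=u+v+\tfrac12[u,v]$, with centre $Z$ and derived group $G'$. Let $a$ and $b$ be the minimal numbers of $\mathfrak o$-module generators of $\mathfrak g/\mathfrak z$ and of $\mathfrak g'$, let $e_1,\dots,e_a\in\mathfrak g$ represent generators of $\mathfrak g/\mathfrak z$, let $f_1,\dots,f_b$ generate $\mathfrak g'$, and choose $\lambda_{ij}^k\in\mathfrak o$ with $\lambda_{ij}^k=-\lambda_{ji}^k$ and $[e_i,e_j]=\sum_{k=1}^b\lambda_{ij}^kf_k$. Let $B(Y)$ be the $a\times a$ matrix of linear forms with $B(Y)_{ij}=\sum_{k=1}^b\lambda_{ij}^kY_k$;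 for a point $y\in\mathbb P^{b-1}(\mathbb F_q)$ let $\operatorname{rk}B(y)$ denote the rank over $\mathbb F_q$ of $B$ evaluated at a representative of $y$. Assume that $a>2$, that $$\{\operatorname{rk}B(y)\mid y\in\mathbb P^{b-1}(\mathbb F_q)\}=\{a-2,a\},$$ and that every line $L\subset\mathbb P^{b-1}(\mathbb F_q)$ contains a point $y$ with $\operatorname{rk}B(y)=a$. Put $n=\#\{y\in\mathbb P^{b-1}(\mathbb F_q)\mid \operatorname{rk}B(y)=a-2\}$. Denote by $\mathrm{cc}_i(G)$ the number of conjugacy classes of $G$ of cardinality $p^i$, by $\mathrm{ch}_i(G)$ the number of irreducible complex characters of $G$ of degree $p^i$, and by $k(G)$ the number of conjugacy classes of $G$. Then $a$ is even, $b>1$, one has $\mathrm{cc}_j(G)=\mathrm{ch}_j(G)=0$ whenever $f\nmid j$, and for all $i\ge 0$ $$\mathrm{cc}_{if}(G)=\begin{cases}|Z| & \text{if } i=0,\\ |Z|\,q^{-b+1}n(q^2-1) & \text{if } i=b-1,\\ |Z|\,q^{-b}(q^a-1-n(q^2-1)) & \text{if } i=b,\\ 0&\text{otherwise,}\end{cases}$$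 $$\mathrm{ch}_{if}(G)=\begin{cases}|G/G'| & \text{if } i=0,\\ |G/G'|\,q^{-a+2}n(q-1) & \text{if } i=a/2-1,\\ |G/G'|\,q^{-a}(q^b-1-n(q-1)) & \text{if } i=a/2,\\ 0&\text{otherwise.}\end{cases}$$ In particular $$k(G)=|G|\left(q^{-a}+q^{-b}+q^{-a-b}\bigl(n(q^2-1)(q-1)-1\bigr)\right).$$ -/

import Mathlib

open scoped LinearAlgebra.Projectivization

/-! ### The group `exp(𝔤)` of a Lie algebra of nilpotency class two -/

/-- In a Lie ring of nilpotency class two all brackets of length three vanish. -/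
theorem lie_lie_eq_zero_of_class_two {𝔤 : Type*} [LieRing 𝔤]
    (h : LieModule.nilpotencyLength 𝔤 𝔤 = 2) (x y z : 𝔤) : ⁅⁅x, y⁆, z⁆ = 0 := by
  have h0 := ((LieModule.nilpotencyLength_eq_succ_iff ℤ 𝔤 𝔤 1).1 h).1
  have hxy : ⁅x, y⁆ ∈ LieModule.lowerCentralSeries ℤ 𝔤 𝔤 1 := by
    rw [LieModule.lowerCentralSeries_succ, LieModule.lowerCentralSeries_zero]
    exact LieSubmodule.lie_mem_lie (LieSubmodule.mem_top x) (LieSubmodule.mem_top y)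
  have hz : ⁅z, ⁅x, y⁆⁆ ∈ LieModule.lowerCentralSeries ℤ 𝔤 𝔤 2 := by
    rw [LieModule.lowerCentralSeries_succ]
    exact LieSubmodule.lie_mem_lie (LieSubmodule.mem_top z) hxy
  rw [h0, LieSubmodule.mem_bot] at hz
  rw [← lie_skew, hz, neg_zero]

/-- The underlying set of the group `exp(𝔤)` associated with an `𝔬`-Lie algebra `𝔤` of nilpotency
class two by the Lazard correspondence: an element is `exp u`, for a unique `u = log (exp u)` in
`𝔤`. -/
@[ext]
structure LazardExp (𝔬 𝔤 : Type*) [CommRing 𝔬] [LieRing 𝔤] [LieAlgebra 𝔬 𝔤]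
    (h : LieModule.nilpotencyLength 𝔤 𝔤 = 2) where
  /-- the element `exp u` -/
  exp ::
  /-- the logarithm -/
  log : 𝔤

/-- The group structure `u ⋆ v = u + v + 1/2 [u, v]` given by the Hausdorff series, all of whose
homogeneous parts of degree at least three vanish on a Lie algebra of class two. Here `1/2` is
the inverse of `2` in `𝔬`; the construction is used only where `2` is a unit. -/
noncomputable instance LazardExp.instGroup (𝔬 𝔤 : Type*) [CommRing 𝔬] [LieRing 𝔤]
    [LieAlgebra 𝔬 𝔤] (h : LieModule.nilpotencyLength 𝔤 𝔤 = 2) : Group (LazardExp 𝔬 𝔤 h) where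
  mul u v := ⟨u.log + v.log + Ring.inverse (2 : 𝔬) • ⁅u.log, v.log⁆⟩
  one := ⟨0⟩
  inv u := ⟨-u.log⟩
  mul_assoc u v w := by
    have h1 := lie_lie_eq_zero_of_class_two h
    have h2 : ∀ x y z : 𝔤, ⁅x, ⁅y, z⁆⁆ = 0 := fun x y z => by
      rw [← lie_skew, h1, neg_zero]
    apply LazardExp.ext
    change (u.log + v.log + Ring.inverse (2 : 𝔬) • ⁅u.log, v.log⁆) + w.log
        + Ring.inverse (2 : 𝔬) • ⁅u.log + v.log + Ring.inverse (2 : 𝔬) • ⁅u.log, v.log⁆, w.log⁆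
      = u.log + (v.log + w.log + Ring.inverse (2 : 𝔬) • ⁅v.log, w.log⁆)
        + Ring.inverse (2 : 𝔬) • ⁅u.log, v.log + w.log + Ring.inverse (2 : 𝔬) • ⁅v.log, w.log⁆⁆
    simp only [add_lie, lie_add, smul_lie, lie_smul, h1, h2, smul_zero, smul_add]
    abel
  one_mul u := by
    apply LazardExp.ext
    change (0 : 𝔤) + u.log + Ring.inverse (2 : 𝔬) • ⁅(0 : 𝔤), u.log⁆ = u.log
    simp
  mul_one u := by
    apply LazardExp.ext
    change u.log + (0 : 𝔤) + Ring.inverse (2 : 𝔬) • ⁅u.log, (0 : 𝔤)⁆ = u.log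
    simp
  inv_mul_cancel u := by
    apply LazardExp.ext
    change -u.log + u.log + Ring.inverse (2 : 𝔬) • ⁅-u.log, u.log⁆ = (0 : 𝔤)
    simp

/-- The derived Lie algebra `𝔤' = [𝔤, 𝔤]`. -/
abbrev lieDerived (𝔬 𝔤 : Type*) [CommRing 𝔬] [LieRing 𝔤] [LieAlgebra 𝔬 𝔤] : LieIdeal 𝔬 𝔤 :=
  ⁅(⊤ : LieIdeal 𝔬 𝔤), (⊤ : LieIdeal 𝔬 𝔤)⁆

/-! ### Class vectors and character vectors -/

/-- `cc_i(G)`: the number of conjugacy classes of `G` of cardinality `p ^ i`. -/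
noncomputable def classVector (p : ℕ) (G : Type*) [Group G] (i : ℕ) : ℕ :=
  Nat.card {C : ConjClasses G // Nat.card C.carrier = p ^ i}

/-- The irreducible complex characters of a finite group `G`: the characters of the irreducible
representations of `G` on the spaces `ℂ ^ d`. -/
def irreducibleCharacters (G : Type*) [Group G] : Set (G → ℂ) :=
  {χ | ∃ (d : ℕ) (ρ : Representation ℂ G (Fin d → ℂ)), ρ.IsIrreducible ∧ ρ.character = χ}

/-- `ch_i(G)`: the number of irreducible complex characters of `G` of degree `p ^ i`. -/
noncomputable def characterVector (p : ℕ) (G : Type*) [Group G] (i : ℕ) : ℕ :=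
  Nat.card {χ : G → ℂ // χ ∈ irreducibleCharacters G ∧ χ 1 = (p : ℂ) ^ i}

/-- The class number `k(G)`. -/
noncomputable def classNumber (G : Type*) [Group G] : ℕ := Nat.card (ConjClasses G)

/-! ### The commutator matrix -/

section CommutatorMatrix

variable {𝔬 : Type*} [CommRing 𝔬] {a b : ℕ}

/-- The commutator matrix `B(Y)` of linear forms over `𝔬` attached to structure constants
`lam i j k`; its `(i, j)` entry is `∑ k, lam i j k * Y_k`. -/
noncomputable def commutatorMatrix (lam : Fin a → Fin a → Fin b → 𝔬) :
    Matrix (Fin a) (Fin a) (MvPolynomial (Fin b) 𝔬) :=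
  Matrix.of fun i j => ∑ k, MvPolynomial.C (lam i j k) * MvPolynomial.X k

/-- The value `B(y)` of the commutator matrix at `y ∈ K ^ b`, for an `𝔬`-algebra `K`. -/
noncomputable def commutatorMatrixAt {K : Type*} [Field K] [Algebra 𝔬 K]
    (lam : Fin a → Fin a → Fin b → 𝔬) (y : Fin b → K) : Matrix (Fin a) (Fin a) K :=
  (commutatorMatrix lam).map (MvPolynomial.aeval y)

theorem commutatorMatrixAt_apply {K : Type*} [Field K] [Algebra 𝔬 K]
    (lam : Fin a → Fin a → Fin b → 𝔬) (y : Fin b → K) (i j : Fin a) :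
    commutatorMatrixAt lam y i j = ∑ k, algebraMap 𝔬 K (lam i j k) * y k := by
  simp [commutatorMatrixAt, commutatorMatrix]

theorem commutatorMatrixAt_smul {K : Type*} [Field K] [Algebra 𝔬 K]
    (lam : Fin a → Fin a → Fin b → 𝔬) (t : K) (y : Fin b → K) :
    commutatorMatrixAt lam (t • y) = t • commutatorMatrixAt lam y := by
  ext i j
  simp only [commutatorMatrixAt_apply, Matrix.smul_apply, Pi.smul_apply, smul_eq_mul,
    Finset.mul_sum]
  exact Finset.sum_congr rfl fun k _ => by ring

/-- The rank of `B(y)` at a point `y` of the projective space `ℙ^(b-1)(K)`. -/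
noncomputable def commutatorRank {K : Type*} [Field K] [Algebra 𝔬 K]
    (lam : Fin a → Fin a → Fin b → 𝔬) (y : ℙ K (Fin b → K)) : ℕ :=
  Projectivization.lift (fun v : {v : Fin b → K // v ≠ 0} => (commutatorMatrixAt lam v.1).rank)
    (by
      rintro ⟨v, hv⟩ ⟨w, hw⟩ t (rfl : v = t • w)
      have ht : t ≠ 0 := fun h0 => hv (by rw [h0, zero_smul])
      simp only [commutatorMatrixAt_smul]
      exact Matrix.rank_smul_of_mem_nonZeroDivisors _ (mem_nonZeroDivisors_of_ne_zero ht)) y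

end CommutatorMatrix

/-!
Conjugacy classes and irreducible characters of `G = exp(𝔤)` are both counted on the additive group
of `𝔤`, where the two counts become counts of vectors over the residue field `K = 𝔽_q` according to
ranks of matrices built from the structure constants.

*Classes.* In class two, conjugation by `exp y` sends `exp x` to `exp (x + [y, x])`, so the class of
`exp x` is the coset `x + [𝔤, x]`. Its size is `q ^ r`, with `r` the rank of the matrix of `ad x`
from the cocentre `K ^ a` to the derived algebra `K ^ b` (`adjointMatrixAt`,
`LazardExp.classVector_mul_pow_eq`).

*Characters.* This is the orbit method in class two. A character `l` of the additive group of `𝔤`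
has the radical `{x | l [x, y] = 1 for all y}`. In an irreducible representation of `G` whose
restriction to the radical is given by the scalars `l`, the trace vanishes off the radical, since
there an element is conjugate to a nontrivial scalar multiple of itself; that the character has norm
one then forces the degree to be the square root of the index of the radical. Schur's lemma shows
that every irreducible representation is of this kind, and the regular representation contains one
for each `l` (`LazardExp.mem_irreducibleCharacters_iff`). Two characters of `𝔤` give the same
irreducible character exactly when they agree on the radical. If `l` restricts to `w ↦ ψ (y · w)` on
the derived algebra, the index of its radical is `q ^ rk B(y)`
(`LazardExp.characterVector_mul_pow_eq`).

*Linear algebra.* A vector `y` annihilates the image of `ad c` exactly when `B(y) c = 0`. If the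
space of such `y` had dimension two or more for some `c ≠ 0`, it would contain a line of points of
deficient rank; hence `ad c` has rank `b` or `b - 1` (`le_rank_adjointMatrixAt_add_one`). Counting
the pairs `(y, c)` with `B(y) c = 0` in two ways, the kernel of `B(y)` having `q ^ 2` elements at
each of the `n` special points, gives `n (q ^ 2 - 1)` vectors `c` for which the rank is `b - 1`
(`card_rank_adjointMatrixAt_eq`).
-/

/-! ### Counting by fibres -/

theorem Nat.card_eq_mul_of_card_fiber {α β : Type*} [Finite α] [Finite β] (φ : α → β) (m : ℕ)
    (h : ∀ y, Nat.card {x // φ x = y} = m) : Nat.card α = Nat.card β * m := by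
  have := Fintype.ofFinite β
  rw [← Nat.card_congr (Equiv.sigmaFiberEquiv φ), Nat.card_sigma]
  simp [h]

/-! ### The group structure of `exp(𝔤)` -/

namespace LazardExp

open scoped commutatorElement

variable {𝔬 𝔤 : Type*} [CommRing 𝔬] [LieRing 𝔤] [LieAlgebra 𝔬 𝔤]
  {h : LieModule.nilpotencyLength 𝔤 𝔤 = 2}

theorem log_mul (u v : LazardExp 𝔬 𝔤 h) :
    (u * v).log = u.log + v.log + Ring.inverse (2 : 𝔬) • ⁅u.log, v.log⁆ := rfl

theorem log_one : (1 : LazardExp 𝔬 𝔤 h).log = 0 := rfl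

theorem log_inv (u : LazardExp 𝔬 𝔤 h) : u⁻¹.log = -u.log := rfl

/-- The logarithm, as a bijection from `exp(𝔤)` onto `𝔤`. -/
def logEquiv (𝔬 : Type*) {𝔤 : Type*} [CommRing 𝔬] [LieRing 𝔤] [LieAlgebra 𝔬 𝔤]
    (h : LieModule.nilpotencyLength 𝔤 𝔤 = 2) : LazardExp 𝔬 𝔤 h ≃ 𝔤 where
  toFun := log
  invFun := exp
  left_inv _ := rfl
  right_inv _ := rfl

instance [Finite 𝔤] : Finite (LazardExp 𝔬 𝔤 h) := Finite.of_equiv _ (logEquiv 𝔬 h).symm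

theorem lie_lie_right_eq_zero (h : LieModule.nilpotencyLength 𝔤 𝔤 = 2) (x y z : 𝔤) :
    ⁅x, ⁅y, z⁆⁆ = 0 := by
  rw [← lie_skew, lie_lie_eq_zero_of_class_two h, neg_zero]

theorem inverse_two_smul_add (h2 : IsUnit (2 : 𝔬)) (x : 𝔤) :
    Ring.inverse (2 : 𝔬) • x + Ring.inverse (2 : 𝔬) • x = x := by
  rw [← add_smul, ← two_mul, Ring.mul_inverse_cancel _ h2, one_smul]

theorem log_conj (h2 : IsUnit (2 : 𝔬)) (u v : LazardExp 𝔬 𝔤 h) :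
    (u * v * u⁻¹).log = v.log + ⁅u.log, v.log⁆ := by
  have h1 := lie_lie_eq_zero_of_class_two h
  have h3 := inverse_two_smul_add (𝔤 := 𝔤) h2
  simp only [log_mul, log_inv, add_lie, lie_neg, smul_lie, h1, smul_zero, lie_self, zero_add,
    add_zero]
  rw [lie_skew]
  conv_rhs => rw [← h3 ⁅u.log, v.log⁆]
  abel

theorem log_mul_of_lie_eq_zero (u v : LazardExp 𝔬 𝔤 h) (huv : ⁅u.log, v.log⁆ = 0) :
    (u * v).log = u.log + v.log := by
  rw [log_mul, huv, smul_zero, add_zero]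

theorem log_commutator (h2 : IsUnit (2 : 𝔬)) (u v : LazardExp 𝔬 𝔤 h) :
    ⁅u, v⁆.log = ⁅u.log, v.log⁆ := by
  rw [commutatorElement_def, log_mul, log_conj h2, log_inv]
  simp [lie_lie_eq_zero_of_class_two h]

theorem mem_center_iff (h2 : IsUnit (2 : 𝔬)) (u : LazardExp 𝔬 𝔤 h) :
    u ∈ Subgroup.center (LazardExp 𝔬 𝔤 h) ↔ u.log ∈ LieAlgebra.center 𝔬 𝔤 := by
  rw [Subgroup.mem_center_iff, LieModule.mem_maxTrivSubmodule]
  constructor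
  · intro hu x
    have := log_conj h2 (exp x) u
    rw [hu, mul_inv_cancel_right] at this
    simpa using this
  · intro hu g
    rw [← mul_inv_eq_iff_eq_mul]
    apply LazardExp.ext
    rw [log_conj h2, hu, add_zero]

theorem card_center (h2 : IsUnit (2 : 𝔬)) :
    Nat.card (Subgroup.center (LazardExp 𝔬 𝔤 h)) = Nat.card (LieAlgebra.center 𝔬 𝔤) :=
  Nat.card_congr ((logEquiv 𝔬 h).subtypeEquiv fun u => mem_center_iff h2 u)

theorem lie_mem_lieDerived (x y : 𝔤) : ⁅x, y⁆ ∈ lieDerived 𝔬 𝔤 :=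
  LieSubmodule.lie_mem_lie (LieSubmodule.mem_top x) (LieSubmodule.mem_top y)

theorem lieDerived_le_center (h : LieModule.nilpotencyLength 𝔤 𝔤 = 2) :
    lieDerived 𝔬 𝔤 ≤ LieAlgebra.center 𝔬 𝔤 := by
  refine (LieSubmodule.lie_le_iff _ _ _).2 fun x _ y _ => ?_
  rw [LieModule.mem_maxTrivSubmodule]
  exact fun z => lie_lie_right_eq_zero h z x y

theorem mem_commutator_iff (h2 : IsUnit (2 : 𝔬)) (u : LazardExp 𝔬 𝔤 h) :
    u ∈ commutator (LazardExp 𝔬 𝔤 h) ↔ u.log ∈ lieDerived 𝔬 𝔤 := by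
  constructor
  · intro hu
    rw [commutator_def, Subgroup.commutator_def] at hu
    induction hu using Subgroup.closure_induction with
    | mem x hx =>
      obtain ⟨g, -, g', -, rfl⟩ := hx
      rw [log_commutator h2]
      exact lie_mem_lieDerived _ _
    | one => exact zero_mem _
    | mul x y _ _ hx hy =>
      rw [log_mul]
      exact add_mem (add_mem hx hy) ((lieDerived 𝔬 𝔤).smul_mem _ (lie_mem_lieDerived _ _))
    | inv x _ hx => exact neg_mem hx
  · intro hu
    suffices H : ∀ w ∈ (lieDerived 𝔬 𝔤).toSubmodule,
        (exp w : LazardExp 𝔬 𝔤 h) ∈ commutator (LazardExp 𝔬 𝔤 h) from H _ hu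
    rw [LieSubmodule.lieIdeal_oper_eq_linear_span']
    intro w hw
    -- Brackets are central, so that `exp` turns a sum of multiples of brackets into a product.
    suffices H : w ∈ LieAlgebra.center 𝔬 𝔤 ∧ ∀ r : 𝔬,
        (exp (r • w) : LazardExp 𝔬 𝔤 h) ∈ commutator (LazardExp 𝔬 𝔤 h) by
      simpa using H.2 1
    induction hw using Submodule.span_induction with
    | mem x hx =>
      obtain ⟨y, -, z, -, rfl⟩ := hx
      refine ⟨lieDerived_le_center h (lie_mem_lieDerived _ _), fun r => ?_⟩
      have : (exp (r • ⁅y, z⁆) : LazardExp 𝔬 𝔤 h) = ⁅(exp (r • y) : LazardExp 𝔬 𝔤 h), exp z⁆ := by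
        apply LazardExp.ext
        rw [log_commutator h2, smul_lie]
      rw [this]
      exact Subgroup.commutator_mem_commutator (Subgroup.mem_top _) (Subgroup.mem_top _)
    | zero =>
      refine ⟨zero_mem _, fun r => ?_⟩
      rw [smul_zero]
      exact one_mem _
    | add x y _ _ hx hy =>
      refine ⟨add_mem hx.1 hy.1, fun r => ?_⟩
      have : (exp (r • (x + y)) : LazardExp 𝔬 𝔤 h) = exp (r • x) * exp (r • y) := by
        apply LazardExp.ext
        rw [log_mul_of_lie_eq_zero, smul_add]
        rw [lie_smul, (LieModule.mem_maxTrivSubmodule 𝔬 𝔤 𝔤 _).1 hy.1, smul_zero]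
      rw [this]
      exact mul_mem (hx.2 r) (hy.2 r)
    | smul s x _ hx =>
      refine ⟨(LieAlgebra.center 𝔬 𝔤).smul_mem s hx.1, fun r => ?_⟩
      rw [smul_smul]
      exact hx.2 _

theorem card_quotient_commutator_mul (h2 : IsUnit (2 : 𝔬)) :
    Nat.card (LazardExp 𝔬 𝔤 h ⧸ commutator (LazardExp 𝔬 𝔤 h)) * Nat.card (lieDerived 𝔬 𝔤)
      = Nat.card 𝔤 := by
  rw [← Nat.card_congr (logEquiv 𝔬 h), Subgroup.card_eq_card_quotient_mul_card_subgroup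
    (commutator (LazardExp 𝔬 𝔤 h))]
  congr 1
  exact (Nat.card_congr ((logEquiv 𝔬 h).subtypeEquiv fun u => mem_commutator_iff h2 u)).symm

/-! ### Conjugacy classes -/

/-- The conjugacy class of `exp x` is the exponential of the coset `x + [𝔤, x]`. -/
theorem card_carrier_mk (h2 : IsUnit (2 : 𝔬)) (g : LazardExp 𝔬 𝔤 h) :
    Nat.card (ConjClasses.mk g).carrier = Nat.card (Set.range fun y : 𝔤 => ⁅y, g.log⁆) := by
  refine Nat.card_congr (((logEquiv 𝔬 h).trans (Equiv.subRight g.log)).subtypeEquiv fun u => ?_)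
  rw [ConjClasses.mem_carrier_iff_mk_eq, eq_comm, ConjClasses.mk_eq_mk_iff_isConj, isConj_iff]
  constructor
  · rintro ⟨c, rfl⟩
    refine ⟨c.log, ?_⟩
    change _ = (c * g * c⁻¹).log - g.log
    rw [log_conj h2, add_sub_cancel_left]
  · rintro ⟨y, hy⟩
    refine ⟨exp y, LazardExp.ext ?_⟩
    change _ = u.log - g.log at hy
    rw [log_conj h2]
    simp only at hy ⊢
    rw [hy, add_sub_cancel]

theorem classVector_mul_pow [Finite 𝔤] (h2 : IsUnit (2 : 𝔬)) (p i : ℕ) :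
    classVector p (LazardExp 𝔬 𝔤 h) i * p ^ i
      = Nat.card {x : 𝔤 // Nat.card (Set.range fun y : 𝔤 => ⁅y, x⁆) = p ^ i} := by
  have e : Nat.card {x : 𝔤 // Nat.card (Set.range fun y : 𝔤 => ⁅y, x⁆) = p ^ i}
      = Nat.card {g : LazardExp 𝔬 𝔤 h // Nat.card (ConjClasses.mk g).carrier = p ^ i} :=
    Nat.card_congr ((logEquiv 𝔬 h).symm.subtypeEquiv fun x => by
      rw [card_carrier_mk h2]; rfl)
  rw [e, classVector]
  refine (Nat.card_eq_mul_of_card_fiber (fun g : {g : LazardExp 𝔬 𝔤 h //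
    Nat.card (ConjClasses.mk g).carrier = p ^ i} =>
    (⟨ConjClasses.mk g.1, g.2⟩ : {C : ConjClasses (LazardExp 𝔬 𝔤 h) //
      Nat.card C.carrier = p ^ i})) _ ?_).symm
  rintro ⟨C, hC⟩
  refine Eq.trans (Nat.card_congr (β := C.carrier)
    { toFun := fun g => ⟨g.1.1, ConjClasses.mem_carrier_iff_mk_eq.2 (congrArg Subtype.val g.2)⟩
      invFun := fun g => ⟨⟨g.1, ?_⟩, Subtype.ext (ConjClasses.mem_carrier_iff_mk_eq.1 g.2)⟩
      left_inv := fun _ => rfl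
      right_inv := fun _ => rfl }) hC
  rw [ConjClasses.mem_carrier_iff_mk_eq.1 g.2, hC]

end LazardExp

/-! ### Characters of finite abelian groups -/

theorem AddChar.exists_extension {A : Type*} [AddCommGroup A] [Finite A] (H : AddSubgroup A)
    (μ : AddChar H ℂ) : ∃ l : AddChar A ℂ, ∀ x : H, l x = μ x := by
  obtain ⟨φ, hφ⟩ := MonoidHom.domRestrict_surjective (M := ℂ) (AddSubgroup.toSubgroup H)
    (μ.toMonoidHom : Multiplicative H →* ℂ).toHomUnits
  refine ⟨AddChar.toMonoidHomEquiv.symm ((Units.coeHom ℂ).comp φ), fun x => ?_⟩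
  have := congrArg Units.val (DFunLike.congr_fun hφ (Multiplicative.ofAdd x))
  exact this

theorem AddChar.apply_ne_zero_of_addGroup {A : Type*} [AddGroup A] (l : AddChar A ℂ) (x : A) :
    l x ≠ 0 := by
  have := l.map_add_eq_mul x (-x)
  rw [add_neg_cancel, AddChar.map_zero_eq_one] at this
  exact left_ne_zero_of_mul (this ▸ one_ne_zero)

theorem AddChar.natCard_complex (A : Type*) [AddCommGroup A] [Finite A] :
    Nat.card (AddChar A ℂ) = Nat.card A := by
  have := Fintype.ofFinite A
  rw [Nat.card_eq_fintype_card, Nat.card_eq_fintype_card, AddChar.card_eq]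

/-- A character of a subgroup `H` of a finite abelian group `A` has `[A : H]` extensions. -/
theorem AddChar.card_eqOn_mul_card {A : Type*} [AddCommGroup A] [Finite A] (H : AddSubgroup A)
    (l₀ : AddChar A ℂ) :
    Nat.card {l : AddChar A ℂ // ∀ x ∈ H, l x = l₀ x} * Nat.card H = Nat.card A := by
  rw [← AddChar.natCard_complex A, ← AddChar.natCard_complex H, mul_comm]
  refine (Nat.card_eq_mul_of_card_fiber
    (fun l : AddChar A ℂ => l.compAddMonoidHom H.subtype) _ fun μ => ?_).symm
  obtain ⟨l₁, hl₁⟩ := AddChar.exists_extension H μ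
  refine Nat.card_congr ((Equiv.addRight (l₀ - l₁)).subtypeEquiv fun l => ?_)
  have hne := l₁.apply_ne_zero_of_addGroup
  have hne' := l₀.apply_ne_zero_of_addGroup
  have key : ∀ x, (Equiv.addRight (l₀ - l₁) l) x = l x * (l₀ x / l₁ x) := fun x => by
    simp [AddChar.sub_apply']
  rw [DFunLike.ext_iff]
  constructor
  · intro hl x hx
    have h1 : l x = l₁ x := (hl ⟨x, hx⟩).trans (hl₁ ⟨x, hx⟩).symm
    rw [key, h1, mul_div_cancel₀ _ (hne x)]
  · rintro hl ⟨x, hx⟩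
    have h1 := hl x hx
    rw [key, mul_div_assoc', div_eq_iff (hne x), mul_comm (l₀ x), mul_left_inj' (hne' x)] at h1
    exact h1.trans (hl₁ ⟨x, hx⟩)

/-! ### Generalities on representations -/

theorem Representation.IsIrreducible.exists_eq_smul_one {G V : Type*} [Group G] [AddCommGroup V]
    [Module ℂ V] [FiniteDimensional ℂ V] {ρ : Representation ℂ G V} (hρ : ρ.IsIrreducible)
    (T : V →ₗ[ℂ] V) (hT : ∀ g, T * ρ g = ρ g * T) : ∃ c : ℂ, T = c • 1 := by
  let f : Representation.IntertwiningMap ρ ρ := ⟨T, fun g => hT g⟩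
  obtain ⟨c, hc⟩ :=
    (Representation.IsIrreducible.algebraMap_intertwiningMap_bijective_of_isAlgClosed (ρ := ρ)).2 f
  refine ⟨c, ?_⟩
  ext v
  have := congrArg (fun F : Representation.IntertwiningMap ρ ρ => F v) hc
  change c • v = T v at this
  simpa using this.symm

/-- A representation on `ℂ ^ d`, `d > 0`, in which every `g ∈ S` acts as the scalar `c g` yields an
irreducible one with the same property. -/
theorem Representation.exists_irreducible_of_smul_fin {G : Type*} [Group G] (S : Set G) (c : G → ℂ)
    (n : ℕ) (hn : 0 < n) (ρ : Representation ℂ G (Fin n → ℂ))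
    (h : ∀ g ∈ S, ∀ v, ρ g v = c g • v) :
    ∃ (d : ℕ) (σ : Representation ℂ G (Fin d → ℂ)), σ.IsIrreducible ∧ ∀ g ∈ S, ∀ v,
      σ g v = c g • v := by
  induction n using Nat.strong_induction_on with
  | _ n ih =>
    by_cases hs : ∀ τ : Subrepresentation ρ, τ = ⊥ ∨ τ = ⊤
    · have : Nontrivial (Subrepresentation ρ) := by
        refine ⟨⊥, ⊤, fun he => ?_⟩
        have hm : (fun _ => 1 : Fin n → ℂ) ∈ (⊥ : Subrepresentation ρ) :=
          he ▸ (Submodule.mem_top : (fun _ => 1 : Fin n → ℂ) ∈ (⊤ : Submodule ℂ (Fin n → ℂ)))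
        have hz : (fun _ => 1 : Fin n → ℂ) = 0 := hm
        exact one_ne_zero (congrFun hz ⟨0, hn⟩)
      exact ⟨n, ρ, ⟨hs⟩, h⟩
    · push Not at hs
      obtain ⟨τ, hb, ht⟩ := hs
      have hlt : Module.finrank ℂ τ.toSubmodule < n := by
        have := Submodule.finrank_lt (s := τ.toSubmodule)
          (fun he => ht (Subrepresentation.toSubmodule_injective he))
        simpa using this
      have hpos : 0 < Module.finrank ℂ τ.toSubmodule := by
        rw [Nat.pos_iff_ne_zero, Ne, Submodule.finrank_eq_zero]
        exact fun he => hb (Subrepresentation.toSubmodule_injective he)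
      let e := (Module.finBasis ℂ τ.toSubmodule).equivFun
      refine ih _ hlt hpos ((e.conjRingEquiv : _ →* _).comp τ.toRepresentation) fun g hg v => ?_
      have h1 : τ.toRepresentation g (e.symm v) = c g • e.symm v := Subtype.ext (h g hg _)
      change e (τ.toRepresentation g (e.symm v)) = _
      rw [h1, map_smul, e.apply_symm_apply]

namespace LazardExp

variable {𝔬 𝔤 : Type*} [CommRing 𝔬] [LieRing 𝔤] [LieAlgebra 𝔬 𝔤]
  {h : LieModule.nilpotencyLength 𝔤 𝔤 = 2}

/-! ### The orbit method for `exp(𝔤)` -/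

/-- The radical of the alternating form `(x, y) ↦ l ([x, y])` attached to a character `l` of the
additive group of `𝔤`. -/
def radical (l : AddChar 𝔤 ℂ) : AddSubgroup 𝔤 where
  carrier := {x | ∀ y, l ⁅x, y⁆ = 1}
  zero_mem' y := by simp
  add_mem' {x x'} hx hx' y := by
    rw [add_lie, AddChar.map_add_eq_mul, hx, hx', one_mul]
  neg_mem' {x} hx y := by
    rw [neg_lie, ← lie_neg]
    exact hx _

theorem mem_radical {l : AddChar 𝔤 ℂ} {x : 𝔤} : x ∈ radical l ↔ ∀ y, l ⁅x, y⁆ = 1 := Iff.rfl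

theorem map_lie_of_mem_radical {l : AddChar 𝔤 ℂ} {x : 𝔤} (hx : x ∈ radical l) (y : 𝔤) :
    l ⁅y, x⁆ = 1 := by
  rw [← lie_skew, ← lie_neg]
  exact hx _

theorem lie_mem_radical (h : LieModule.nilpotencyLength 𝔤 𝔤 = 2) (l : AddChar 𝔤 ℂ) (x y : 𝔤) :
    ⁅x, y⁆ ∈ radical l := fun z => by
  rw [lie_lie_eq_zero_of_class_two h, AddChar.map_zero_eq_one]

open Classical in
/-- The class function on `exp(𝔤)` attached to a character `l` of the additive group of `𝔤`: it
vanishes off the radical of `l`, where it is the multiple of `l` whose value at `1` is the square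
root of the index of the radical. -/
noncomputable def orbitCharacter (h : LieModule.nilpotencyLength 𝔤 𝔤 = 2) (l : AddChar 𝔤 ℂ)
    (g : LazardExp 𝔬 𝔤 h) : ℂ :=
  if g.log ∈ radical l then (Real.sqrt (radical l).index : ℂ) * l g.log else 0

theorem exp_lie_mul (h2 : IsUnit (2 : 𝔬)) (u v : LazardExp 𝔬 𝔤 h) :
    u * v * u⁻¹ = exp ⁅u.log, v.log⁆ * v := by
  apply LazardExp.ext
  rw [log_conj h2, log_mul_of_lie_eq_zero _ _ (lie_lie_eq_zero_of_class_two h _ _ _), add_comm]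

/-- In an irreducible representation whose restriction to the radical of `l` is given by `l`,
elements off the radical have trace zero, being conjugate to a nontrivial scalar multiple of
themselves; the degree then follows from the norm of an irreducible character being one. -/
theorem character_eq_orbitCharacter [Finite 𝔤] (h2 : IsUnit (2 : 𝔬)) (l : AddChar 𝔤 ℂ) {V : Type*}
    [AddCommGroup V] [Module ℂ V] [FiniteDimensional ℂ V]
    {ρ : Representation ℂ (LazardExp 𝔬 𝔤 h) V} (hρ : ρ.IsIrreducible)
    (hl : ∀ x ∈ radical l, ∀ v, ρ (exp x) v = l x • v) :
    ρ.character = orbitCharacter h l := by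
  classical
  have := Fintype.ofFinite (LazardExp 𝔬 𝔤 h)
  have hl' : ∀ x ∈ radical l, ρ (exp x) = l x • 1 := fun x hx => LinearMap.ext (hl x hx)
  set d := Module.finrank ℂ V with hd
  have hin : ∀ g : LazardExp 𝔬 𝔤 h, g.log ∈ radical l → ρ.character g = d * l g.log := by
    intro g hg
    change LinearMap.trace ℂ V (ρ (exp g.log)) = _
    rw [hl' _ hg, map_smul, LinearMap.trace_one, smul_eq_mul, mul_comm]
  have hout : ∀ g : LazardExp 𝔬 𝔤 h, g.log ∉ radical l → ρ.character g = 0 := by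
    intro g hg
    rw [mem_radical] at hg
    push Not at hg
    obtain ⟨y, hy⟩ := hg
    have hc := ρ.char_conj g (exp (-y))
    rw [exp_lie_mul h2] at hc
    have hz : ρ.character (exp ⁅-y, g.log⁆ * g) = l ⁅-y, g.log⁆ * ρ.character g := by
      change LinearMap.trace ℂ V (ρ _) = _
      rw [map_mul, hl' _ (lie_mem_radical h l _ _), smul_mul_assoc, one_mul, map_smul]
      rfl
    change ρ.character (exp ⁅-y, g.log⁆ * g) = _ at hc
    rw [hz, neg_lie, lie_skew] at hc
    by_contra hne
    exact hy (mul_right_cancel₀ hne (by rw [hc, one_mul]))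
  have hdeg : (d : ℝ) = Real.sqrt (radical l).index := by
    have hG : (Nat.card (LazardExp 𝔬 𝔤 h) : ℂ) ≠ 0 := Nat.cast_ne_zero.2 Nat.card_pos.ne'
    have : Invertible (Nat.card (LazardExp 𝔬 𝔤 h) : ℂ) := invertibleOfNonzero hG
    have h1 := ρ.char_orthonormal ρ
    rw [if_pos ⟨Representation.Equiv.refl ρ⟩] at h1
    have h3 : ∀ g : LazardExp 𝔬 𝔤 h, ρ.character g * ρ.character g⁻¹
        = if g.log ∈ radical l then (d : ℂ) ^ 2 else 0 := by
      intro g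
      split_ifs with hg
      · rw [hin g hg, hin g⁻¹ (neg_mem hg), log_inv]
        have : l g.log * l (-g.log) = 1 := by
          rw [← AddChar.map_add_eq_mul, add_neg_cancel, AddChar.map_zero_eq_one]
        linear_combination (d : ℂ) ^ 2 * this
      · rw [hout g hg, zero_mul]
    have h4 : Nat.card {g : LazardExp 𝔬 𝔤 h // g.log ∈ radical l} = Nat.card (radical l) :=
      Nat.card_congr ((logEquiv 𝔬 h).subtypeEquiv fun _ => Iff.rfl)
    simp only [h3, Finset.sum_ite, Finset.sum_const_zero, add_zero, Finset.sum_const,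
      nsmul_eq_mul] at h1
    rw [← Fintype.card_subtype, ← Nat.card_eq_fintype_card, h4, inv_mul_eq_one₀ hG,
      Nat.card_congr (logEquiv 𝔬 h), ← (radical l).card_mul_index] at h1
    have h5 : (radical l).index = d ^ 2 :=
      Nat.eq_of_mul_eq_mul_left (Nat.card_pos (α := radical l)) (by exact_mod_cast h1)
    rw [h5, Nat.cast_pow, Real.sqrt_sq (Nat.cast_nonneg _)]
  ext g
  rw [orbitCharacter]
  split_ifs with hg
  · rw [hin g hg, ← hdeg, Complex.ofReal_natCast]
  · exact hout g hg

/-- By Schur's lemma the elements `exp x` with all `ρ (exp [x, y])` trivial act as scalars. These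
scalars form a character of the group of all such `x`, and any extension of it to `𝔤` has this group
as its radical. -/
theorem exists_orbitCharacter_eq [Finite 𝔤] (h2 : IsUnit (2 : 𝔬)) {V : Type*}
    [AddCommGroup V] [Module ℂ V] [FiniteDimensional ℂ V]
    {ρ : Representation ℂ (LazardExp 𝔬 𝔤 h) V} (hρ : ρ.IsIrreducible) :
    ∃ l : AddChar 𝔤 ℂ, orbitCharacter h l = ρ.character := by
  have hV : ∃ v : V, v ≠ 0 := by
    by_contra hv
    push Not at hv
    obtain ⟨τ, τ', hτ⟩ := hρ.exists_pair_ne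
    exact hτ (Subrepresentation.toSubmodule_injective (Submodule.ext fun v => by simp [hv v]))
  obtain ⟨v₀, hv₀⟩ := hV
  have hmul : ∀ x y : 𝔤, ⁅x, y⁆ = 0 →
      ρ (exp (x + y)) = ρ (exp x) * ρ (exp y) := fun x y hxy => by
    rw [← map_mul]
    congr 1
    exact LazardExp.ext (log_mul_of_lie_eq_zero _ _ hxy).symm
  have hone : ρ (exp 0) = 1 := ρ.map_one
  -- The exponential of `R` is the preimage of the scalar operators.
  let R : AddSubgroup 𝔤 :=
    { carrier := {x | ∀ y, ρ (exp ⁅x, y⁆) = 1}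
      zero_mem' := fun y => by rw [zero_lie, hone]
      add_mem' := fun {x x'} hx hx' y => by
        rw [add_lie, hmul _ _ (lie_lie_eq_zero_of_class_two h _ _ _), hx, hx', one_mul]
      neg_mem' := fun {x} hx y => by
        rw [neg_lie, ← lie_neg]
        exact hx _ }
  have hsc : ∀ x : R, ∃ c : ℂ, ρ (exp x.1) = c • 1 := fun x => by
    refine hρ.exists_eq_smul_one _ fun g => ?_
    have h1 := exp_lie_mul h2 g (exp x.1)
    rw [mul_inv_eq_iff_eq_mul] at h1
    have h3 := congrArg ρ h1
    simp only [map_mul] at h3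
    rw [h3, ← lie_skew, ← lie_neg, x.2, one_mul]
  choose c hc using hsc
  have hinj : ∀ s t : ℂ, s • (1 : V →ₗ[ℂ] V) = t • 1 → s = t := fun s t hst => by
    have := LinearMap.congr_fun hst v₀
    exact smul_left_injective ℂ hv₀ (by simpa using this)
  have hcadd : ∀ x y : R, c (x + y) = c x * c y := fun x y => by
    apply hinj
    rw [← hc, mul_smul, ← hc y, ← smul_one_mul, ← hc x, ← map_mul]
    have h1 : (exp x.1 * exp y.1 : LazardExp 𝔬 𝔤 h)
        = exp (x + y : R).1 * exp ⁅x.1, Ring.inverse (2 : 𝔬) • y.1⁆ := by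
      apply LazardExp.ext
      rw [log_mul_of_lie_eq_zero _ _ (lie_lie_right_eq_zero h _ _ _), log_mul, lie_smul]
      rfl
    rw [h1, map_mul, x.2, mul_one]
  let μ : AddChar R ℂ :=
    { toFun := c
      map_zero_eq_one' := hinj _ _ (by rw [← hc, one_smul]; exact hone)
      map_add_eq_mul' := hcadd }
  obtain ⟨l, hl⟩ := AddChar.exists_extension R μ
  have hlR : ∀ x (hx : x ∈ R), ρ (exp x) = l x • 1 := fun x hx =>
    (hc ⟨x, hx⟩).trans (by rw [hl ⟨x, hx⟩]; rfl)
  have hlieR : ∀ x y : 𝔤, ⁅x, y⁆ ∈ R := fun x y z => by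
    rw [lie_lie_eq_zero_of_class_two h, hone]
  refine ⟨l, (character_eq_orbitCharacter h2 l hρ fun x hx v => ?_).symm⟩
  have hxR : x ∈ R := fun y => by rw [hlR _ (hlieR x y), hx y, one_smul]
  rw [hlR x hxR]
  rfl

/-- Every `l` occurs: the subspace of a representation on which the radical acts by `l` is stable
under the group, because `l` is invariant under conjugation there. -/
theorem exists_character_eq_orbitCharacter [Finite 𝔤] (h2 : IsUnit (2 : 𝔬)) (l : AddChar 𝔤 ℂ) :
    ∃ (d : ℕ) (ρ : Representation ℂ (LazardExp 𝔬 𝔤 h) (Fin d → ℂ)),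
      ρ.IsIrreducible ∧ ρ.character = orbitCharacter h l := by
  classical
  -- The right regular representation, and in it the subspace on which the radical acts by `l`.
  let reg : Representation ℂ (LazardExp 𝔬 𝔤 h) (LazardExp 𝔬 𝔤 h → ℂ) :=
    { toFun := fun g => LinearMap.funLeft ℂ ℂ (· * g)
      map_one' := by ext; simp [LinearMap.funLeft]
      map_mul' := fun g g' => by ext; simp [LinearMap.funLeft, mul_assoc] }
  let τ : Subrepresentation reg :=
    { toSubmodule := ⨅ r : radical l, LinearMap.ker (reg (exp r.1) - l r.1 • 1)
      apply_mem_toSubmodule := fun g F hF => by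
        simp only [Submodule.mem_iInf, LinearMap.mem_ker, LinearMap.sub_apply, sub_eq_zero,
          LinearMap.smul_apply, Module.End.one_apply] at hF ⊢
        rintro ⟨r, hr⟩
        have h1 : (exp r * g : LazardExp 𝔬 𝔤 h) = g * exp (r + ⁅-g.log, r⁆) := by
          rw [← inv_mul_eq_iff_eq_mul, ← mul_assoc]
          apply LazardExp.ext
          have := log_conj h2 g⁻¹ (exp r)
          rwa [inv_inv] at this
        have h3 := hF ⟨_, add_mem hr (lie_mem_radical h l (-g.log) r)⟩
        rw [AddChar.map_add_eq_mul, map_lie_of_mem_radical hr, mul_one] at h3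
        change (reg (exp r) * reg g) F = _
        rw [← map_mul, h1, map_mul, Module.End.mul_apply, h3, map_smul] }
  have hτ : ∀ r ∈ radical l, ∀ v, τ.toRepresentation (exp r) v = l r • v := fun r hr v => by
    have h1 := (Submodule.mem_iInf _).1 v.2 ⟨r, hr⟩
    rw [LinearMap.mem_ker, LinearMap.sub_apply, sub_eq_zero] at h1
    exact Subtype.ext h1
  -- This subspace contains the extension of `l` by zero.
  have hF : (fun g => if g.log ∈ radical l then l g.log else 0) ∈ τ.toSubmodule := by
    refine (Submodule.mem_iInf _).2 fun ⟨r, hr⟩ => ?_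
    rw [LinearMap.mem_ker, LinearMap.sub_apply, sub_eq_zero]
    ext g
    change (if (g * exp r).log ∈ radical l then l (g * exp r).log else 0)
      = l r * (if g.log ∈ radical l then l g.log else 0)
    have h1 : ⁅g.log, Ring.inverse (2 : 𝔬) • r⁆ ∈ radical l := lie_mem_radical h l _ _
    have h3 : l ⁅g.log, Ring.inverse (2 : 𝔬) • r⁆ = 1 := by
      rw [lie_smul, ← smul_lie]
      exact map_lie_of_mem_radical hr _
    rw [log_mul, ← lie_smul, AddSubgroup.add_mem_cancel_right _ h1,
      AddSubgroup.add_mem_cancel_right _ hr]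
    split_ifs
    · rw [AddChar.map_add_eq_mul, AddChar.map_add_eq_mul, h3, mul_one, mul_comm]
    · rw [mul_zero]
  have hpos : 0 < Module.finrank ℂ τ.toSubmodule := by
    rw [Nat.pos_iff_ne_zero, Ne, Submodule.finrank_eq_zero]
    intro hb
    rw [hb, Submodule.mem_bot] at hF
    have h1 := congrFun hF 1
    have h0 : (1 : LazardExp 𝔬 𝔤 h).log ∈ radical l := zero_mem _
    rw [if_pos h0] at h1
    exact l.apply_ne_zero_of_addGroup _ h1
  let e := (Module.finBasis ℂ τ.toSubmodule).equivFun
  obtain ⟨d, σ, hσ, hσl⟩ := Representation.exists_irreducible_of_smul_fin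
    {g | g.log ∈ radical l} (fun g => l g.log) _ hpos
    ((e.conjRingEquiv : _ →* _).comp τ.toRepresentation) fun g hg v => by
      change e (τ.toRepresentation (exp g.log) (e.symm v)) = _
      rw [hτ _ hg, map_smul, e.apply_symm_apply]
  exact ⟨d, σ, hσ, character_eq_orbitCharacter h2 l hσ fun x hx v => hσl (exp x) hx v⟩

/-- The irreducible characters of `exp(𝔤)` are the functions attached to characters of `𝔤`. -/
theorem mem_irreducibleCharacters_iff [Finite 𝔤] (h2 : IsUnit (2 : 𝔬))
    (χ : LazardExp 𝔬 𝔤 h → ℂ) :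
    χ ∈ irreducibleCharacters (LazardExp 𝔬 𝔤 h) ↔ ∃ l, orbitCharacter h l = χ := by
  constructor
  · rintro ⟨d, ρ, hρ, rfl⟩
    exact exists_orbitCharacter_eq h2 hρ
  · rintro ⟨l, rfl⟩
    exact exists_character_eq_orbitCharacter h2 l

theorem orbitCharacter_one (l : AddChar 𝔤 ℂ) :
    orbitCharacter h l (1 : LazardExp 𝔬 𝔤 h) = (Real.sqrt (radical l).index : ℂ) := by
  have h0 : (1 : LazardExp 𝔬 𝔤 h).log ∈ radical l := zero_mem _
  rw [orbitCharacter, if_pos h0, log_one, AddChar.map_zero_eq_one, mul_one]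

theorem index_radical_ne_zero [Finite 𝔤] (l : AddChar 𝔤 ℂ) :
    (Real.sqrt (radical l).index : ℂ) ≠ 0 := by
  rw [Complex.ofReal_ne_zero, Real.sqrt_ne_zero (Nat.cast_nonneg _), Nat.cast_ne_zero]
  exact AddSubgroup.index_ne_zero_of_finite

theorem orbitCharacter_eq_iff [Finite 𝔤] (l l' : AddChar 𝔤 ℂ) :
    orbitCharacter (𝔬 := 𝔬) h l' = orbitCharacter h l ↔ ∀ x ∈ radical l, l' x = l x := by
  have hsupp : ∀ (m : AddChar 𝔤 ℂ) x,
      orbitCharacter h m (exp x : LazardExp 𝔬 𝔤 h) ≠ 0 ↔ x ∈ radical m := fun m x => by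
    rw [orbitCharacter]
    split_ifs with hx
    · exact iff_of_true (mul_ne_zero (index_radical_ne_zero m) (m.apply_ne_zero_of_addGroup _)) hx
    · exact iff_of_false (by simp) hx
  classical
  constructor
  · intro he
    have hr : radical l' = radical l := by
      ext x
      rw [← hsupp, ← hsupp, he]
    intro x hx
    have h1 := congrFun he (exp x)
    rw [orbitCharacter, orbitCharacter, hr] at h1
    change (if x ∈ radical l then _ else _) = (if x ∈ radical l then _ else _) at h1
    rw [if_pos hx, if_pos hx] at h1
    exact mul_left_cancel₀ (index_radical_ne_zero l) h1
  · intro he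
    -- The radical depends only on the values on brackets, which lie in every radical.
    have hr : radical l' = radical l := by
      ext x
      simp only [mem_radical, he _ (lie_mem_radical h l _ _)]
    ext g
    rw [orbitCharacter, orbitCharacter, hr]
    split_ifs with hg
    · rw [he _ hg]
    · rfl

/-- An irreducible character of degree `p ^ i` arises from `p ^ (2 * i)` characters of `𝔤`. -/
theorem characterVector_mul_pow [Finite 𝔤] (h2 : IsUnit (2 : 𝔬)) {p : ℕ} (hp : 0 < p) (i : ℕ) :
    characterVector p (LazardExp 𝔬 𝔤 h) i * p ^ (2 * i)
      = Nat.card {l : AddChar 𝔤 ℂ // (radical l).index = p ^ (2 * i)} := by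
  have hdeg : ∀ l : AddChar 𝔤 ℂ, orbitCharacter h l (1 : LazardExp 𝔬 𝔤 h) = (p : ℂ) ^ i ↔
      (radical l).index = p ^ (2 * i) := fun l => by
    rw [orbitCharacter_one, ← Complex.ofReal_natCast p, ← Complex.ofReal_pow, Complex.ofReal_inj,
      Real.sqrt_eq_iff_eq_sq (Nat.cast_nonneg _) (by positivity), ← pow_mul, mul_comm i]
    exact_mod_cast Iff.rfl
  let φ : {l : AddChar 𝔤 ℂ // (radical l).index = p ^ (2 * i)} →
      {χ : LazardExp 𝔬 𝔤 h → ℂ // χ ∈ irreducibleCharacters (LazardExp 𝔬 𝔤 h) ∧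
        χ 1 = (p : ℂ) ^ i} := fun l =>
    ⟨orbitCharacter h l.1, (mem_irreducibleCharacters_iff h2 _).2 ⟨l, rfl⟩, (hdeg l).2 l.2⟩
  have hφ : Function.Surjective φ := by
    rintro ⟨χ, hχ, hχ1⟩
    obtain ⟨l, rfl⟩ := (mem_irreducibleCharacters_iff h2 _).1 hχ
    exact ⟨⟨l, (hdeg l).1 hχ1⟩, rfl⟩
  have := Finite.of_surjective φ hφ
  refine (Nat.card_eq_mul_of_card_fiber φ _ fun χ => ?_).symm
  obtain ⟨⟨l, hl⟩, rfl⟩ := hφ χ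
  have h1 := AddChar.card_eqOn_mul_card (radical l) l
  rw [← (radical l).index_mul_card, hl] at h1
  have e : {l' // φ l' = φ ⟨l, hl⟩} ≃ {l' : AddChar 𝔤 ℂ // ∀ x ∈ radical l, l' x = l x} :=
    { toFun := fun l' => ⟨l'.1.1, (orbitCharacter_eq_iff (𝔬 := 𝔬) (h := h) l l'.1.1).1
        (congrArg Subtype.val l'.2)⟩
      invFun := fun l' => ⟨⟨l'.1, (hdeg l'.1).1
        (by rw [(orbitCharacter_eq_iff l l'.1).2 l'.2, (hdeg l).2 hl])⟩,
        Subtype.ext ((orbitCharacter_eq_iff l l'.1).2 l'.2)⟩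
      left_inv := fun _ => Subtype.ext (Subtype.ext rfl)
      right_inv := fun _ => Subtype.ext rfl }
  exact (Nat.card_congr e).trans (Nat.eq_of_mul_eq_mul_right Nat.card_pos h1)

end LazardExp

/-! ### Ranks of the commutator matrix over a finite field -/

theorem Matrix.card_ker_mul_pow_rank {K m n : Type*} [Field K] [Finite K] [Fintype m] [Fintype n]
    (M : Matrix m n K) :
    Nat.card {v : n → K // M.mulVec v = 0} * Nat.card K ^ M.rank
      = Nat.card K ^ Fintype.card n := by
  have h1 := M.mulVecLin.finrank_range_add_finrank_ker
  rw [Module.finrank_fintype_fun_eq_card] at h1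
  have h2 : Nat.card {v : n → K // M.mulVec v = 0} = Nat.card (LinearMap.ker M.mulVecLin) := rfl
  rw [h2, Module.natCard_eq_pow_finrank (K := K) (V := LinearMap.ker M.mulVecLin), ← pow_add,
    ← h1, add_comm]
  rfl

/-- The sizes of the fibres of a function `r` on a finite set, which takes only two values off a
point `x₀`, in terms of the size of one of them. -/
theorem card_fibers_of_two_values {X : Type*} [Finite X] (x₀ : X) (r : X → ℕ) (s t m : ℕ)
    (h0 : r x₀ = 0) (hst : ∀ x ≠ x₀, r x = s ∨ r x = t) (hs : 0 < s) (hlt : s < t)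
    (hm : Nat.card {x // r x = s} = m) (i : ℕ) :
    (Nat.card {x // r x = i} : ℚ) = if i = 0 then 1 else if i = s then (m : ℚ)
      else if i = t then (Nat.card X : ℚ) - 1 - m else 0 := by
  classical
  have := Fintype.ofFinite X
  have hr : ∀ x, r x = 0 ↔ x = x₀ := fun x => by
    refine ⟨fun hx => ?_, fun hx => hx ▸ h0⟩
    by_contra hne
    rcases hst x hne with h | h <;> omega
  have h1 : Nat.card {x // r x = 0} = 1 := by
    simp only [hr]
    simp
  split_ifs with hi hi' hi''
  · rw [hi, h1, Nat.cast_one]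
  · rw [hi', hm]
  · have hsum : Nat.card X = 1 + m + Nat.card {x // r x = t} := by
      rw [← h1, ← hm]
      simp only [Nat.card_eq_fintype_card, Fintype.card_subtype]
      rw [← Finset.card_union_of_disjoint, ← Finset.card_union_of_disjoint, ← Finset.card_univ]
      · congr 1
        ext x
        by_cases hx : x = x₀
        · simp [hx, h0]
        · simpa [or_assoc] using Or.inr (hst x hx)
      · rw [Finset.disjoint_left]
        simp only [Finset.mem_union, Finset.mem_filter_univ]
        omega
      · rw [Finset.disjoint_left]
        simp only [Finset.mem_filter_univ]
        omega
    rw [hi'', hsum]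
    push_cast
    ring
  · rw [Nat.cast_eq_zero, Nat.card_eq_zero]
    refine Or.inl ⟨fun x => ?_⟩
    by_cases hx : x.1 = x₀
    · exact hi (by rw [← x.2, hx, h0])
    · rcases hst x.1 hx with h | h
      · exact hi' (x.2.symm.trans h)
      · exact hi'' (x.2.symm.trans h)

section CommutatorMatrix

variable {𝔬 K : Type*} [CommRing 𝔬] [Field K] [Algebra 𝔬 K] {a b : ℕ}
  (lam : Fin a → Fin a → Fin b → 𝔬)

/-- The matrix of `x ↦ [x, c]`, from the cocentre to the derived algebra, in terms of structure
constants `lam i j k`. -/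
noncomputable def adjointMatrixAt (c : Fin a → K) : Matrix (Fin b) (Fin a) K :=
  Matrix.of fun k i => ∑ j, algebraMap 𝔬 K (lam i j k) * c j

/-- The commutator matrix and the adjoint matrix encode the same trilinear form. -/
theorem commutatorMatrixAt_mulVec (y : Fin b → K) (c : Fin a → K) :
    (commutatorMatrixAt lam y).mulVec c = (adjointMatrixAt lam c).transpose.mulVec y := by
  ext i
  simp only [Matrix.mulVec, dotProduct, commutatorMatrixAt_apply, Matrix.transpose_apply,
    adjointMatrixAt, Matrix.of_apply, Finset.sum_mul]
  rw [Finset.sum_comm]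
  exact Finset.sum_congr rfl fun _ _ => Finset.sum_congr rfl fun _ _ => by ring

theorem commutatorMatrixAt_zero : commutatorMatrixAt lam (0 : Fin b → K) = 0 := by
  ext i j
  simp [commutatorMatrixAt_apply]

theorem adjointMatrixAt_zero : adjointMatrixAt lam (0 : Fin a → K) = 0 := by
  ext i j
  simp [adjointMatrixAt]

theorem eq_zero_of_commutatorMatrixAt_mulVec {y : Fin b → K} {c : Fin a → K}
    (hy : (commutatorMatrixAt lam y).rank = a) (hc : (commutatorMatrixAt lam y).mulVec c = 0) :
    c = 0 := by
  have h1 := (commutatorMatrixAt lam y).mulVecLin.finrank_range_add_finrank_ker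
  have h2 : Module.finrank K (LinearMap.range (commutatorMatrixAt lam y).mulVecLin) = a := hy
  rw [h2, Module.finrank_fin_fun, Nat.add_eq_left, Submodule.finrank_eq_zero,
    LinearMap.ker_eq_bot'] at h1
  exact h1 c hc

/-- A skew-symmetric commutator matrix can only be invertible in even size. -/
theorem even_of_rank_commutatorMatrixAt_eq (h2 : (2 : K) ≠ 0)
    (hskew : ∀ i j k, lam i j k = -lam j i k) (y : Fin b → K)
    (hy : (commutatorMatrixAt lam y).rank = a) : Even a := by
  by_contra ha
  rw [Nat.not_even_iff_odd] at ha
  have ht : (commutatorMatrixAt lam y).transpose = -commutatorMatrixAt lam y := by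
    ext i j
    simp only [Matrix.transpose_apply, Matrix.neg_apply, commutatorMatrixAt_apply]
    rw [← Finset.sum_neg_distrib]
    exact Finset.sum_congr rfl fun k _ => by rw [hskew, map_neg, neg_mul]
  have hd := Matrix.det_transpose (commutatorMatrixAt lam y)
  rw [ht, Matrix.det_neg, Fintype.card_fin, ha.neg_one_pow] at hd
  have h0 : (commutatorMatrixAt lam y).det = 0 := by
    have : (2 : K) * (commutatorMatrixAt lam y).det = 0 := by linear_combination -hd
    exact (mul_eq_zero.1 this).resolve_left h2
  obtain ⟨v, hv, hv0⟩ := Matrix.exists_mulVec_eq_zero_iff.2 h0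
  exact hv (eq_zero_of_commutatorMatrixAt_mulVec lam hy hv0)

/-- If `c ≠ 0` lay in the radical of `B(y)` for all `y` in a plane, no point of the corresponding
line would have full rank. -/
theorem le_rank_adjointMatrixAt_add_one
    (hlines : ∀ L : Projectivization.Subspace K (Fin b → K),
      Module.finrank K (Projectivization.Subspace.submodule L) = 2 →
        ∃ y ∈ L, commutatorRank lam y = a)
    {c : Fin a → K} (hc : c ≠ 0) : b ≤ (adjointMatrixAt lam c).rank + 1 := by
  by_contra hlt
  push Not at hlt
  have h1 := (adjointMatrixAt lam c).transpose.mulVecLin.finrank_range_add_finrank_ker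
  have h2 : Module.finrank K (LinearMap.range (adjointMatrixAt lam c).transpose.mulVecLin)
    = (adjointMatrixAt lam c).rank := (adjointMatrixAt lam c).rank_transpose
  rw [h2, Module.finrank_fin_fun] at h1
  obtain ⟨w, hw⟩ := exists_linearIndependent_of_le_finrank
    (show 2 ≤ Module.finrank K (LinearMap.ker (adjointMatrixAt lam c).transpose.mulVecLin) by omega)
  have hw' := hw.map' (Submodule.subtype _) (Submodule.ker_subtype _)
  obtain ⟨y, hy, hyr⟩ := hlines (Submodule.projectivization (Submodule.span K (Set.range
    (Submodule.subtype (LinearMap.ker (adjointMatrixAt lam c).transpose.mulVecLin) ∘ w)))) (by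
      rw [Submodule.projectivization, OrderIso.apply_symm_apply, finrank_span_eq_card hw',
        Fintype.card_fin])
  induction y using Projectivization.ind with
  | h v hv =>
    rw [Submodule.mk_mem_projectivization_iff] at hy
    have h3 : (adjointMatrixAt lam c).transpose.mulVec v = 0 := by
      refine (Submodule.span_le (p := LinearMap.ker
        (adjointMatrixAt lam c).transpose.mulVecLin)).2 ?_ hy
      rintro _ ⟨i, rfl⟩
      exact (w i).2
    rw [← commutatorMatrixAt_mulVec] at h3
    exact hc (eq_zero_of_commutatorMatrixAt_mulVec lam hyr h3)

/-- Each point of projective space has `|K| - 1` representatives. -/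
theorem card_rank_eq_card_commutatorRank_mul [Finite K] {r : ℕ} (hr : r ≠ 0) :
    Nat.card {v : Fin b → K // (commutatorMatrixAt lam v).rank = r}
      = Nat.card {y : ℙ K (Fin b → K) // commutatorRank lam y = r} * (Nat.card K - 1) := by
  have hne : ∀ v : Fin b → K, (commutatorMatrixAt lam v).rank = r → v ≠ 0 := by
    rintro v hv rfl
    rw [commutatorMatrixAt_zero, Matrix.rank_zero] at hv
    exact hr hv.symm
  rw [← Nat.card_units]
  refine Nat.card_eq_mul_of_card_fiber (fun v : {v : Fin b → K //
    (commutatorMatrixAt lam v).rank = r} => (⟨Projectivization.mk K v.1 (hne _ v.2), v.2⟩ :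
      {y : ℙ K (Fin b → K) // commutatorRank lam y = r})) _ ?_
  rintro ⟨y, hy⟩
  induction y using Projectivization.ind with
  | h w hw =>
    have hmem : ∀ t : Kˣ, (commutatorMatrixAt lam (t • w)).rank = r := fun t => by
      rw [Units.smul_def, commutatorMatrixAt_smul,
        Matrix.rank_smul_of_mem_nonZeroDivisors _ (mem_nonZeroDivisors_of_ne_zero t.ne_zero)]
      exact hy
    refine (Nat.card_congr (Equiv.ofBijective (fun t : Kˣ => ⟨⟨t • w, hmem t⟩, Subtype.ext
      ((Projectivization.mk_eq_mk_iff K _ _ (hne _ (hmem t)) hw).2 ⟨t, rfl⟩)⟩) ⟨?_, ?_⟩)).symm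
    · intro t t' htt
      have h1 : (t : K) • w = (t' : K) • w := congrArg (fun z => z.1.1) htt
      exact Units.ext (smul_left_injective K hw h1)
    · rintro ⟨⟨v, hv⟩, hvw⟩
      obtain ⟨t, ht⟩ := (Projectivization.mk_eq_mk_iff K _ _ (hne v hv) hw).1
        (congrArg Subtype.val hvw)
      exact ⟨t, Subtype.ext (Subtype.ext ht)⟩

/-- Counting the pairs `(y, c)` with `B(y) c = 0` in two ways. -/
theorem card_rank_adjointMatrixAt_eq [Finite K] (ha : 2 < a) (hb : 1 < b)
    (hrank : ∀ y : Fin b → K, y ≠ 0 →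
      (commutatorMatrixAt lam y).rank = a - 2 ∨ (commutatorMatrixAt lam y).rank = a)
    (hadj : ∀ c : Fin a → K, c ≠ 0 → b ≤ (adjointMatrixAt lam c).rank + 1) (n : ℕ)
    (hn : Nat.card {y : Fin b → K // (commutatorMatrixAt lam y).rank = a - 2}
      = n * (Nat.card K - 1)) :
    Nat.card {c : Fin a → K // (adjointMatrixAt lam c).rank = b - 1}
      = n * (Nat.card K ^ 2 - 1) := by
  classical
  have := Fintype.ofFinite K
  set q := Nat.card K with hq
  have hq1 : 1 < q := Finite.one_lt_card
  have hqa : (Nat.card (Fin a → K) : ℤ) = q ^ a := by simp [hq]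
  have hqb : (Nat.card (Fin b → K) : ℤ) = q ^ b := by simp [hq]
  have hker : ∀ y : Fin b → K,
      ((Finset.univ.filter fun c : Fin a → K => (commutatorMatrixAt lam y).mulVec c = 0).card : ℤ)
        = 1 + (if y = 0 then (q : ℤ) ^ a - 1 else 0)
          + if (commutatorMatrixAt lam y).rank = a - 2 then (q : ℤ) ^ 2 - 1 else 0 := by
    intro y
    have h1 := (commutatorMatrixAt lam y).card_ker_mul_pow_rank
    rw [Fintype.card_fin, Nat.card_eq_fintype_card, Fintype.card_subtype] at h1
    by_cases hy : y = 0
    · rw [hy, commutatorMatrixAt_zero, Matrix.rank_zero, if_pos rfl, if_neg (by omega)]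
      rw [hy, commutatorMatrixAt_zero, Matrix.rank_zero, pow_zero, mul_one] at h1
      rw [h1]
      push_cast
      ring
    · rw [if_neg hy]
      rcases hrank y hy with h | h
      · rw [if_pos h]
        have h2 : q ^ a = q ^ 2 * q ^ (a - 2) := by rw [← pow_add]; congr 1; omega
        rw [h, ← hq, h2] at h1
        rw [Nat.eq_of_mul_eq_mul_right (by positivity) h1]
        push_cast
        ring
      · rw [if_neg (by omega)]
        rw [h, ← hq] at h1
        rw [Nat.eq_of_mul_eq_mul_right (by positivity) (h1.trans (one_mul _).symm)]
        simp
  have hker' : ∀ c : Fin a → K,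
      ((Finset.univ.filter fun y : Fin b → K => (commutatorMatrixAt lam y).mulVec c = 0).card : ℤ)
        = 1 + (if c = 0 then (q : ℤ) ^ b - 1 else 0)
          + if (adjointMatrixAt lam c).rank = b - 1 then (q : ℤ) - 1 else 0 := by
    intro c
    simp only [commutatorMatrixAt_mulVec]
    have h1 := (adjointMatrixAt lam c).transpose.card_ker_mul_pow_rank
    rw [Fintype.card_fin, Nat.card_eq_fintype_card, Fintype.card_subtype,
      Matrix.rank_transpose] at h1
    by_cases hc : c = 0
    · rw [hc, adjointMatrixAt_zero, Matrix.rank_zero, if_pos rfl, if_neg (by omega)]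
      rw [hc, adjointMatrixAt_zero, Matrix.rank_zero, pow_zero, mul_one] at h1
      rw [h1]
      push_cast
      ring
    · rw [if_neg hc]
      have hle := hadj c hc
      have hle' : (adjointMatrixAt lam c).rank ≤ b := by
        simpa using (adjointMatrixAt lam c).rank_le_card_height
      rcases (show (adjointMatrixAt lam c).rank = b - 1 ∨ (adjointMatrixAt lam c).rank = b by
        omega) with h | h
      · rw [if_pos h]
        have h2 : q ^ b = q * q ^ (b - 1) := by
          rw [← pow_succ']; congr 1; omega
        rw [h, ← hq, h2] at h1
        rw [Nat.eq_of_mul_eq_mul_right (by positivity) h1]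
        ring
      · rw [if_neg (by omega)]
        rw [h, ← hq] at h1
        rw [Nat.eq_of_mul_eq_mul_right (by positivity) (h1.trans (one_mul _).symm)]
        simp
  have hcount := Finset.sum_card_bipartiteAbove_eq_sum_card_bipartiteBelow
    (s := (Finset.univ : Finset (Fin b → K))) (t := (Finset.univ : Finset (Fin a → K)))
    (fun y c => (commutatorMatrixAt lam y).mulVec c = 0)
  simp only [Finset.bipartiteAbove, Finset.bipartiteBelow] at hcount
  have hcount' := congrArg (Nat.cast : ℕ → ℤ) hcount
  rw [Nat.cast_sum, Nat.cast_sum, Finset.sum_congr rfl fun y _ => hker y,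
    Finset.sum_congr rfl fun c _ => hker' c] at hcount'
  simp only [Finset.sum_add_distrib, Finset.sum_ite_eq', Finset.mem_univ, if_true,
    Finset.sum_const, Finset.card_univ, nsmul_eq_mul, mul_one, ← Finset.sum_filter,
    ← Fintype.card_subtype, ← Nat.card_eq_fintype_card, hn, hqa, hqb] at hcount'
  have hcast : ((q - 1 : ℕ) : ℤ) = q - 1 := by push_cast [hq1.le]; ring
  have hcast2 : ((q ^ 2 - 1 : ℕ) : ℤ) = q ^ 2 - 1 := by
    rw [Nat.cast_sub (Nat.one_le_pow _ _ (by omega))]; push_cast; ring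
  have hne : (q : ℤ) - 1 ≠ 0 := by omega
  rw [← Nat.cast_inj (R := ℤ)]
  apply mul_right_cancel₀ hne
  push_cast [hcast, hcast2] at hcount' ⊢
  linear_combination -hcount'

end CommutatorMatrix

/-! ### Coordinates on the cocentre and the derived algebra -/

/-- A minimal generating family of a module over a local ring that is annihilated by the maximal
ideal is a basis over the residue field. -/
theorem IsLocalRing.exists_linearEquiv_residueField {𝔬 M : Type*} [CommRing 𝔬] [IsLocalRing 𝔬]
    [AddCommGroup M] [Module 𝔬 M]
    (hM : IsLocalRing.maximalIdeal 𝔬 ≤ Module.annihilator 𝔬 M) {a : ℕ}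
    (ha : (⊤ : Submodule 𝔬 M).spanFinrank = a) (v : Fin a → M)
    (hv : Submodule.span 𝔬 (Set.range v) = ⊤) :
    ∃ L : M ≃ₗ[𝔬] (Fin a → IsLocalRing.ResidueField 𝔬), ∀ c : Fin a → 𝔬,
      L (∑ i, c i • v i) = fun i => algebraMap 𝔬 (IsLocalRing.ResidueField 𝔬) (c i) := by
  classical
  let S : (Fin a → 𝔬) →ₗ[𝔬] M := Fintype.linearCombination 𝔬 v
  let ρ : (Fin a → 𝔬) →ₗ[𝔬] (Fin a → IsLocalRing.ResidueField 𝔬) :=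
    (Algebra.linearMap 𝔬 (IsLocalRing.ResidueField 𝔬)).compLeft (Fin a)
  have hS : Function.Surjective S := by
    rw [← LinearMap.range_eq_top, Fintype.range_linearCombination, hv]
  have hρ : Function.Surjective ρ := fun y => by
    choose c hc using fun i => IsLocalRing.residue_surjective (R := 𝔬) (y i)
    exact ⟨c, funext hc⟩
  have hker : LinearMap.ker S = LinearMap.ker ρ := by
    ext c
    rw [LinearMap.mem_ker, LinearMap.mem_ker]
    have hρ0 : ρ c = 0 ↔ ∀ i, c i ∈ IsLocalRing.maximalIdeal 𝔬 := by
      rw [funext_iff]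
      exact forall_congr' fun i => IsLocalRing.residue_eq_zero_iff (c i)
    rw [hρ0]
    constructor
    · intro hc i
      by_contra hi
      rw [IsLocalRing.mem_maximalIdeal, mem_nonunits_iff, not_not] at hi
      obtain ⟨u, hu⟩ := hi
      -- A relation with a unit coefficient makes one generator superfluous.
      have hvi : v i ∈ Submodule.span 𝔬 (v '' {i}ᶜ) := by
        have h1 : c i • v i = -∑ j ∈ {i}ᶜ, c j • v j := by
          rw [eq_neg_iff_add_eq_zero, ← hc, Fintype.linearCombination_apply,
            Fintype.sum_eq_add_sum_compl i]
        have h2 : v i = (↑u⁻¹ : 𝔬) • -∑ j ∈ {i}ᶜ, c j • v j := by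
          rw [← h1, smul_smul, ← hu, Units.inv_mul, one_smul]
        rw [h2]
        refine Submodule.smul_mem _ _ (neg_mem (Submodule.sum_mem _ fun j hj => ?_))
        refine Submodule.smul_mem _ _ (Submodule.subset_span ⟨j, ?_, rfl⟩)
        simpa using hj
      have htop : Submodule.span 𝔬 (v '' {i}ᶜ) = ⊤ := by
        rw [eq_top_iff, ← hv, Submodule.span_le]
        rintro _ ⟨j, rfl⟩
        by_cases hj : j = i
        · rw [hj]
          exact hvi
        · exact Submodule.subset_span ⟨j, hj, rfl⟩
      have hfin : (v '' ({i}ᶜ : Set (Fin a))).Finite := Set.toFinite _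
      have h3 := Submodule.spanFinrank_span_le_ncard_of_finite (R := 𝔬) hfin
      rw [htop, ha] at h3
      have h4 := Set.ncard_image_le (f := v) (Set.toFinite ({i}ᶜ : Set (Fin a)))
      have h5 : ({i}ᶜ : Set (Fin a)).ncard = a - 1 := by
        rw [Set.ncard_compl, Set.ncard_singleton, Nat.card_fin]
      have := i.pos
      omega
    · intro hc
      change Fintype.linearCombination 𝔬 v c = 0
      rw [Fintype.linearCombination_apply]
      exact Finset.sum_eq_zero fun i _ => Module.mem_annihilator.1 (hM (hc i)) _
  refine ⟨(S.quotKerEquivOfSurjective hS).symm ≪≫ₗ Submodule.quotEquivOfEq _ _ hker ≪≫ₗ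
    ρ.quotKerEquivOfSurjective hρ, fun c => ?_⟩
  have h1 : (S.quotKerEquivOfSurjective hS).symm (∑ i, c i • v i)
      = Submodule.Quotient.mk c := by
    rw [LinearEquiv.symm_apply_eq]
    rfl
  rw [LinearEquiv.trans_apply, LinearEquiv.trans_apply, h1]
  rfl

namespace LazardExp

variable {𝔬 𝔤 : Type*} [CommRing 𝔬] [LieRing 𝔤] [LieAlgebra 𝔬 𝔤]

/-- Coordinates `π` on the cocentre and `κ` on the derived algebra, in which the Lie bracket is
given by the structure constants. -/
theorem exists_coordinates [IsLocalRing 𝔬]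
    (hcocentre : IsLocalRing.maximalIdeal 𝔬 ≤
      Module.annihilator 𝔬 (𝔤 ⧸ (LieAlgebra.center 𝔬 𝔤).toSubmodule))
    (hderived : IsLocalRing.maximalIdeal 𝔬 ≤ Module.annihilator 𝔬 (lieDerived 𝔬 𝔤))
    {a b : ℕ}
    (ha : (⊤ : Submodule 𝔬 (𝔤 ⧸ (LieAlgebra.center 𝔬 𝔤).toSubmodule)).spanFinrank = a)
    (hb : (lieDerived 𝔬 𝔤).toSubmodule.spanFinrank = b)
    (e : Fin a → 𝔤) (f' : Fin b → 𝔤)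
    (he : Submodule.span 𝔬
      (Set.range fun i => (LieAlgebra.center 𝔬 𝔤).toSubmodule.mkQ (e i)) = ⊤)
    (hf' : Submodule.span 𝔬 (Set.range f') = (lieDerived 𝔬 𝔤).toSubmodule)
    (lam : Fin a → Fin a → Fin b → 𝔬)
    (hlam : ∀ i j, ⁅e i, e j⁆ = ∑ k, lam i j k • f' k) :
    ∃ (π : 𝔤 →ₗ[𝔬] (Fin a → IsLocalRing.ResidueField 𝔬))
      (κ : lieDerived 𝔬 𝔤 ≃ₗ[𝔬] (Fin b → IsLocalRing.ResidueField 𝔬)),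
      Function.Surjective π ∧ LinearMap.ker π = (LieAlgebra.center 𝔬 𝔤).toSubmodule ∧
      ∀ x y, κ ⟨⁅x, y⁆, lie_mem_lieDerived x y⟩ = (adjointMatrixAt lam (π y)).mulVec (π x) := by
  obtain ⟨L, hL⟩ := IsLocalRing.exists_linearEquiv_residueField hcocentre ha _ he
  have hmem : ∀ k, f' k ∈ lieDerived 𝔬 𝔤 := fun k => by
    rw [← LieSubmodule.mem_toSubmodule, ← hf']
    exact Submodule.subset_span ⟨k, rfl⟩
  have hspan : Submodule.span 𝔬
      (Set.range fun k => (⟨f' k, hmem k⟩ : (lieDerived 𝔬 𝔤).toSubmodule)) = ⊤ := by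
    apply Submodule.map_injective_of_injective (lieDerived 𝔬 𝔤).toSubmodule.injective_subtype
    rw [Submodule.map_span, Submodule.map_top, Submodule.range_subtype, ← Set.range_comp]
    exact hf'
  obtain ⟨κ, hκ⟩ := IsLocalRing.exists_linearEquiv_residueField
    (M := (lieDerived 𝔬 𝔤).toSubmodule) hderived ((Submodule.spanFinrank_top _).trans hb) _ hspan
  let π : 𝔤 →ₗ[𝔬] (Fin a → IsLocalRing.ResidueField 𝔬) :=
    L.toLinearMap ∘ₗ (LieAlgebra.center 𝔬 𝔤).toSubmodule.mkQ
  have hπker : LinearMap.ker π = (LieAlgebra.center 𝔬 𝔤).toSubmodule := by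
    rw [LinearEquiv.ker_comp, Submodule.ker_mkQ]
  have hπe : ∀ c : Fin a → 𝔬, π (∑ i, c i • e i)
      = fun i => algebraMap 𝔬 (IsLocalRing.ResidueField 𝔬) (c i) := fun c => by
    rw [← hL]
    simp [π]
  refine ⟨π, κ, L.surjective.comp (Submodule.mkQ_surjective _), hπker, fun x y => ?_⟩
  have hlift : ∀ x : 𝔤, ∃ c : Fin a → 𝔬, x - ∑ i, c i • e i ∈ LieAlgebra.center 𝔬 𝔤 ∧
      π x = fun i => algebraMap 𝔬 (IsLocalRing.ResidueField 𝔬) (c i) := fun x => by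
    choose c hc using fun i => IsLocalRing.residue_surjective (R := 𝔬) (π x i)
    have h1 : π x = fun i => algebraMap 𝔬 (IsLocalRing.ResidueField 𝔬) (c i) :=
      (funext hc).symm
    refine ⟨c, ?_, h1⟩
    rw [← LieSubmodule.mem_toSubmodule, ← hπker, LinearMap.mem_ker, map_sub, hπe, h1, sub_self]
  obtain ⟨c, hc, hcπ⟩ := hlift x
  obtain ⟨d, hd, hdπ⟩ := hlift y
  have hxy : ⁅x, y⁆ = ∑ k, (∑ i, ∑ j, c i * d j * lam i j k) • f' k := by
    have h1 : ⁅x, y⁆ = ⁅∑ i, c i • e i, ∑ j, d j • e j⁆ := by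
      have h2 : ⁅x, y - ∑ j, d j • e j⁆ = 0 := (LieModule.mem_maxTrivSubmodule 𝔬 𝔤 𝔤 _).1 hd x
      have h3 : ⁅x - ∑ i, c i • e i, ∑ j, d j • e j⁆ = 0 := by
        rw [← lie_skew, (LieModule.mem_maxTrivSubmodule 𝔬 𝔤 𝔤 _).1 hc, neg_zero]
      rw [lie_sub, sub_eq_zero] at h2
      rw [sub_lie, sub_eq_zero] at h3
      rw [h2, h3]
    rw [h1]
    rw [sum_lie_sum]
    simp only [Finset.sum_smul]
    refine Eq.trans (Finset.sum_congr rfl fun i _ => ?_) Finset.sum_comm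
    refine Eq.trans (Finset.sum_congr rfl fun j _ => ?_) Finset.sum_comm
    rw [smul_lie, lie_smul, hlam, smul_smul, Finset.smul_sum]
    exact Finset.sum_congr rfl fun k _ => smul_smul _ _ _
  have hsub : (⟨⁅x, y⁆, lie_mem_lieDerived x y⟩ : (lieDerived 𝔬 𝔤).toSubmodule)
      = ∑ k, (∑ i, ∑ j, c i * d j * lam i j k) •
        (⟨f' k, hmem k⟩ : (lieDerived 𝔬 𝔤).toSubmodule) :=
    Subtype.ext (by rw [Submodule.coe_sum]; exact hxy)
  refine (congrArg κ hsub).trans ?_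
  rw [hκ, hcπ, hdπ]
  ext k
  simp only [map_sum, map_mul, adjointMatrixAt, Matrix.mulVec, dotProduct, Matrix.of_apply,
    Finset.sum_mul]
  exact Finset.sum_congr rfl fun _ _ => Finset.sum_congr rfl fun _ _ => by ring

end LazardExp

/-! ### Class sizes and radicals in coordinates -/

theorem LinearMap.card_subtype_comp {R A B : Type*} [Ring R] [AddCommGroup A] [AddCommGroup B]
    [Module R A] [Module R B] [Finite A] (π : A →ₗ[R] B) (hπ : Function.Surjective π)
    (P : B → Prop) :
    Nat.card {x // P (π x)} = Nat.card {c // P c} * Nat.card (LinearMap.ker π) := by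
  have := Finite.of_surjective π hπ
  refine Nat.card_eq_mul_of_card_fiber
    (fun x : {x // P (π x)} => (⟨π x.1, x.2⟩ : {c // P c})) _ ?_
  rintro ⟨c, hc⟩
  obtain ⟨x₀, rfl⟩ := hπ c
  have e : {x : {x // P (π x)} // (⟨π x.1, x.2⟩ : {c // P c}) = ⟨π x₀, hc⟩}
      ≃ LinearMap.ker π :=
    { toFun := fun x => ⟨x.1.1 - x₀, by
        rw [LinearMap.mem_ker, map_sub, sub_eq_zero]
        exact congrArg Subtype.val x.2⟩
      invFun := fun z =>
        have hz : π (z.1 + x₀) = π x₀ := by rw [map_add, z.2, zero_add]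
        ⟨⟨z.1 + x₀, hz.symm ▸ hc⟩, Subtype.ext hz⟩
      left_inv := fun x => Subtype.ext (Subtype.ext (sub_add_cancel _ _))
      right_inv := fun z => Subtype.ext (add_sub_cancel_right _ _) }
  exact Nat.card_congr e

/-- Over a finite field, a nontrivial additive character pairs `K ^ b` perfectly with itself. -/
theorem AddChar.eq_zero_of_forall_dotProduct {K : Type*} [Field K] {ψ : AddChar K ℂ}
    (hψ : ψ ≠ 1) {m : Type*} [Fintype m] (u : m → K) (hu : ∀ v, ψ (u ⬝ᵥ v) = 1) : u = 0 := by
  classical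
  ext i
  by_contra hi
  refine AddChar.IsPrimitive.of_ne_one hψ hi (DFunLike.ext _ _ fun t => ?_)
  have := hu (Pi.single i t)
  rw [dotProduct_single] at this
  rw [AddChar.mulShift_apply, this, AddChar.one_apply]

/-- Characters of `A`, sorted by their restrictions to a subgroup `H` identified with `K ^ b`. -/
theorem AddChar.exists_dotProduct_restriction {K : Type*} [Field K] [Finite K] {ψ : AddChar K ℂ}
    (hψ : ψ ≠ 1) {A : Type*} [AddCommGroup A] [Finite A] (H : AddSubgroup A) {b : ℕ}
    (κ : H ≃+ (Fin b → K)) :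
    ∃ Ψ : AddChar A ℂ → (Fin b → K), (∀ l (w : H), l w = ψ (Ψ l ⬝ᵥ κ w)) ∧
      ∀ y, Nat.card {l // Ψ l = y} * Nat.card H = Nat.card A := by
  let Φ : (Fin b → K) → AddChar (Fin b → K) ℂ := fun y =>
    { toFun := fun v => ψ (y ⬝ᵥ v)
      map_zero_eq_one' := by rw [dotProduct_zero, AddChar.map_zero_eq_one]
      map_add_eq_mul' := fun v w => by rw [dotProduct_add, AddChar.map_add_eq_mul] }
  have hΦi : Function.Injective Φ := fun y y' hyy => by
    rw [← sub_eq_zero]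
    refine AddChar.eq_zero_of_forall_dotProduct hψ _ fun v => ?_
    have h1 : ψ (y ⬝ᵥ v) = ψ (y' ⬝ᵥ v) := DFunLike.congr_fun hyy v
    rw [sub_dotProduct, AddChar.map_sub_eq_div, h1, div_self (ψ.apply_ne_zero_of_addGroup _)]
  have hΦ : Function.Bijective Φ := by
    rw [Nat.bijective_iff_injective_and_card]
    exact ⟨hΦi, (AddChar.natCard_complex _).symm⟩
  have hex : ∀ l : AddChar A ℂ, ∃ y, ∀ w : H, l w = ψ (y ⬝ᵥ κ w) := fun l => by
    obtain ⟨y, hy⟩ := hΦ.2 (l.compAddMonoidHom (H.subtype.comp κ.symm.toAddMonoidHom))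
    refine ⟨y, fun w => ?_⟩
    have h1 := (DFunLike.congr_fun hy (κ w)).symm
    simpa [Φ] using h1
  choose Ψ hΨ using hex
  refine ⟨Ψ, hΨ, fun y => ?_⟩
  obtain ⟨l₀, hl₀⟩ := AddChar.exists_extension H ((Φ y).compAddMonoidHom κ.toAddMonoidHom)
  have hl₀' : ∀ w : H, l₀ w = ψ (y ⬝ᵥ κ w) := hl₀
  rw [← AddChar.card_eqOn_mul_card H l₀]
  congr 1
  refine Nat.card_congr (Equiv.subtypeEquivRight fun l => ?_)
  constructor
  · rintro rfl x hx
    rw [hΨ l ⟨x, hx⟩, ← hl₀' ⟨x, hx⟩]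
  · intro hl
    refine hΦi (DFunLike.ext _ _ fun v => ?_)
    change ψ (Ψ l ⬝ᵥ v) = ψ (y ⬝ᵥ v)
    have h1 := hl₀' (κ.symm v)
    have h2 := hΨ l (κ.symm v)
    rw [κ.apply_symm_apply] at h1 h2
    rw [← h1, ← h2, hl _ (κ.symm v).2]

namespace LazardExp

variable {𝔬 𝔤 K : Type*} [CommRing 𝔬] [LieRing 𝔤] [LieAlgebra 𝔬 𝔤] [Finite 𝔤]
  [Field K] [Finite K] [Algebra 𝔬 K] {a b : ℕ} {lam : Fin a → Fin a → Fin b → 𝔬}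
  {π : 𝔤 →ₗ[𝔬] (Fin a → K)} {κ : lieDerived 𝔬 𝔤 ≃ₗ[𝔬] (Fin b → K)}

omit [Finite 𝔤] in
theorem card_range_lie (hπ : Function.Surjective π)
    (hκ : ∀ x y, κ ⟨⁅x, y⁆, lie_mem_lieDerived x y⟩ = (adjointMatrixAt lam (π y)).mulVec (π x))
    (x : 𝔤) :
    Nat.card (Set.range fun y : 𝔤 => ⁅y, x⁆) = Nat.card K ^ (adjointMatrixAt lam (π x)).rank := by
  let ι : (Fin b → K) → 𝔤 := fun v => (κ.symm v).1
  have hι : Function.Injective ι := Subtype.val_injective.comp κ.symm.injective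
  have h1 : (Set.range fun y : 𝔤 => ⁅y, x⁆)
      = ι '' (LinearMap.range (adjointMatrixAt lam (π x)).mulVecLin : Set (Fin b → K)) := by
    ext w
    constructor
    · rintro ⟨y, rfl⟩
      refine ⟨_, ⟨π y, rfl⟩, ?_⟩
      change (κ.symm ((adjointMatrixAt lam (π x)).mulVec (π y))).1 = _
      rw [← hκ, κ.symm_apply_apply]
    · rintro ⟨_, ⟨v, rfl⟩, rfl⟩
      obtain ⟨y, rfl⟩ := hπ v
      refine ⟨y, ?_⟩
      change _ = (κ.symm ((adjointMatrixAt lam (π x)).mulVec (π y))).1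
      rw [← hκ, κ.symm_apply_apply]
  rw [h1, Nat.card_image_of_injective hι]
  exact Module.natCard_eq_pow_finrank (K := K)

omit [Finite K] in
theorem card_eq_card_ker_mul (hπ : Function.Surjective π) :
    Nat.card 𝔤 = Nat.card K ^ a * Nat.card (LinearMap.ker π) := by
  have h1 := π.card_subtype_comp hπ fun _ => True
  rwa [Nat.card_congr (Equiv.subtypeUnivEquiv fun _ : 𝔤 => trivial),
    Nat.card_congr (Equiv.subtypeUnivEquiv fun _ : Fin a → K => trivial),
    Nat.card_fun, Nat.card_fin] at h1

/-- The radical of a character with restriction `w ↦ ψ (y · w)` to the derived algebra is the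
preimage of the radical of `B(y)`. -/
theorem index_radical_eq {ψ : AddChar K ℂ} (hψ : ψ ≠ 1) (hπ : Function.Surjective π)
    (hκ : ∀ x y, κ ⟨⁅x, y⁆, lie_mem_lieDerived x y⟩ = (adjointMatrixAt lam (π y)).mulVec (π x))
    (l : AddChar 𝔤 ℂ) (y : Fin b → K) (hl : ∀ w : lieDerived 𝔬 𝔤, l w = ψ (y ⬝ᵥ κ w)) :
    (radical l).index = Nat.card K ^ (commutatorMatrixAt lam y).rank := by
  have hmem : ∀ x, x ∈ radical l ↔ (commutatorMatrixAt lam y).mulVec (π x) = 0 := by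
    intro x
    have h1 : ∀ z, l ⁅z, x⁆ = ψ ((commutatorMatrixAt lam y).mulVec (π x) ⬝ᵥ π z) := fun z => by
      rw [commutatorMatrixAt_mulVec, Matrix.mulVec_transpose, ← Matrix.dotProduct_mulVec, ← hκ]
      exact hl ⟨⁅z, x⁆, lie_mem_lieDerived z x⟩
    constructor
    · intro hx
      refine AddChar.eq_zero_of_forall_dotProduct hψ _ fun v => ?_
      obtain ⟨z, rfl⟩ := hπ v
      rw [← h1, map_lie_of_mem_radical hx]
    · intro hx z
      rw [← lie_skew, ← neg_lie, h1, hx, zero_dotProduct, AddChar.map_zero_eq_one]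
  have h1 : Nat.card (radical l) = _ :=
    (Nat.card_congr (Equiv.subtypeEquivRight hmem)).trans
      (π.card_subtype_comp hπ fun c => (commutatorMatrixAt lam y).mulVec c = 0)
  have h2 := (radical l).card_mul_index
  rw [card_eq_card_ker_mul hπ] at h2
  have h3 := (commutatorMatrixAt lam y).card_ker_mul_pow_rank
  rw [Fintype.card_fin] at h3
  refine Nat.eq_of_mul_eq_mul_left (Nat.card_pos (α := radical l)) ?_
  rw [h2, ← h3, h1]
  ring

variable {h : LieModule.nilpotencyLength 𝔤 𝔤 = 2}

theorem classVector_mul_pow_eq (h2 : IsUnit (2 : 𝔬)) (hπ : Function.Surjective π)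
    (hπker : LinearMap.ker π = (LieAlgebra.center 𝔬 𝔤).toSubmodule)
    (hκ : ∀ x y, κ ⟨⁅x, y⁆, lie_mem_lieDerived x y⟩ = (adjointMatrixAt lam (π y)).mulVec (π x))
    (p j : ℕ) :
    classVector p (LazardExp 𝔬 𝔤 h) j * p ^ j
      = Nat.card {c : Fin a → K // Nat.card K ^ (adjointMatrixAt lam c).rank = p ^ j}
        * Nat.card (Subgroup.center (LazardExp 𝔬 𝔤 h)) := by
  rw [classVector_mul_pow h2, card_center h2]
  simp only [card_range_lie hπ hκ]
  rw [π.card_subtype_comp hπ fun c => Nat.card K ^ (adjointMatrixAt lam c).rank = p ^ j, hπker]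
  rfl

theorem characterVector_mul_pow_eq (h2 : IsUnit (2 : 𝔬)) (hπ : Function.Surjective π)
    (hκ : ∀ x y, κ ⟨⁅x, y⁆, lie_mem_lieDerived x y⟩ = (adjointMatrixAt lam (π y)).mulVec (π x))
    {p : ℕ} (hp : 0 < p) (j : ℕ) :
    characterVector p (LazardExp 𝔬 𝔤 h) j * p ^ (2 * j)
      = Nat.card {y : Fin b → K // Nat.card K ^ (commutatorMatrixAt lam y).rank = p ^ (2 * j)}
        * Nat.card (LazardExp 𝔬 𝔤 h ⧸ commutator (LazardExp 𝔬 𝔤 h)) := by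
  obtain ⟨ψ, hψ⟩ := AddChar.exists_apply_ne_zero.2 (one_ne_zero (α := K))
  have hψ1 : ψ ≠ 1 := fun he => hψ (by rw [he, AddChar.one_apply])
  obtain ⟨Ψ, hΨ, hcard⟩ := AddChar.exists_dotProduct_restriction hψ1
    (lieDerived 𝔬 𝔤).toSubmodule.toAddSubgroup κ.toAddEquiv
  have hidx : ∀ l, (radical l).index = Nat.card K ^ (commutatorMatrixAt lam (Ψ l)).rank :=
    fun l => index_radical_eq hψ1 hπ hκ l (Ψ l) (hΨ l)
  rw [characterVector_mul_pow h2 hp]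
  simp only [hidx]
  refine Nat.card_eq_mul_of_card_fiber (fun l : {l : AddChar 𝔤 ℂ //
    Nat.card K ^ (commutatorMatrixAt lam (Ψ l)).rank = p ^ (2 * j)} => (⟨Ψ l.1, l.2⟩ :
    {y : Fin b → K // Nat.card K ^ (commutatorMatrixAt lam y).rank = p ^ (2 * j)})) _ ?_
  rintro ⟨y, hy⟩
  have h3 := (hcard y).trans (card_quotient_commutator_mul (h := h) h2).symm
  have e : {l : {l : AddChar 𝔤 ℂ //
      Nat.card K ^ (commutatorMatrixAt lam (Ψ l)).rank = p ^ (2 * j)} //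
      (⟨Ψ l.1, l.2⟩ : {y : Fin b → K //
        Nat.card K ^ (commutatorMatrixAt lam y).rank = p ^ (2 * j)}) = ⟨y, hy⟩}
      ≃ {l // Ψ l = y} :=
    { toFun := fun l => ⟨l.1.1, congrArg Subtype.val l.2⟩
      invFun := fun l => ⟨⟨l.1, l.2.symm ▸ hy⟩, Subtype.ext l.2⟩
      left_inv := fun _ => Subtype.ext (Subtype.ext rfl)
      right_inv := fun _ => Subtype.ext rfl }
  exact (Nat.card_congr e).trans (Nat.eq_of_mul_eq_mul_right Nat.card_pos h3)

end LazardExp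

/-! ### Class vector, character vector and class number -/

theorem card_eq_add_of_three_values {X : Type*} [Finite X] (r : X → ℕ) (u v w : ℕ)
    (huv : u ≠ v) (huw : u ≠ w) (hvw : v ≠ w) (hr : ∀ x, r x = u ∨ r x = v ∨ r x = w) :
    Nat.card X = Nat.card {x // r x = u} + Nat.card {x // r x = v} + Nat.card {x // r x = w} := by
  classical
  have := Fintype.ofFinite X
  simp only [Nat.card_eq_fintype_card, Fintype.card_subtype]
  rw [← Finset.card_univ, Finset.card_eq_sum_card_fiberwise (f := r) (t := {u, v, w})
    fun x _ => by simpa using hr x, Finset.sum_insert (by simp [huv, huw]),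
    Finset.sum_insert (by simpa using hvw), Finset.sum_singleton, add_assoc]

/-- A local ring whose residue field has odd cardinality contains `1/2`. -/
theorem IsLocalRing.isUnit_two_of_odd_card {𝔬 : Type*} [CommRing 𝔬] [IsLocalRing 𝔬]
    (h : Odd (Nat.card (IsLocalRing.ResidueField 𝔬))) : IsUnit (2 : 𝔬) := by
  have hfin : Finite (IsLocalRing.ResidueField 𝔬) := Nat.finite_of_card_ne_zero h.pos.ne'
  have := Fintype.ofFinite (IsLocalRing.ResidueField 𝔬)
  rw [← IsLocalRing.residue_ne_zero_iff_isUnit, map_ofNat]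
  intro h2
  obtain ⟨m, hm⟩ := h
  have h0 := Nat.cast_card_eq_zero (IsLocalRing.ResidueField 𝔬)
  rw [← Nat.card_eq_fintype_card, hm] at h0
  push_cast at h0
  rw [h2, zero_mul, zero_add] at h0
  exact one_ne_zero h0

theorem mainTheorem5
    -- a discrete valuation ring with residue field of odd cardinality `q = p ^ f`
    {𝔬 : Type*} [CommRing 𝔬] [IsDomain 𝔬] [IsDiscreteValuationRing 𝔬]
    (p f q : ℕ) (hp : p.Prime) (hp2 : p ≠ 2) (hqf : q = p ^ f)
    (hq : Nat.card (IsLocalRing.ResidueField 𝔬) = q)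
    -- a finite `𝔬`-Lie algebra of nilpotency class two
    {𝔤 : Type*} [LieRing 𝔤] [LieAlgebra 𝔬 𝔤] [Finite 𝔤]
    (hclass : LieModule.nilpotencyLength 𝔤 𝔤 = 2)
    -- cocentre and derived algebra are annihilated by the maximal ideal
    (hcocentre : IsLocalRing.maximalIdeal 𝔬 ≤
      Module.annihilator 𝔬 (𝔤 ⧸ (LieAlgebra.center 𝔬 𝔤).toSubmodule))
    (hderived : IsLocalRing.maximalIdeal 𝔬 ≤
      Module.annihilator 𝔬 (lieDerived 𝔬 𝔤))
    -- `a` and `b` are the ranks of cocentre and derived algebra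
    (a b : ℕ)
    (ha : (⊤ : Submodule 𝔬 (𝔤 ⧸ (LieAlgebra.center 𝔬 𝔤).toSubmodule)).spanFinrank = a)
    (hb : (lieDerived 𝔬 𝔤).toSubmodule.spanFinrank = b)
    -- representatives `e` of generators of the cocentre, generators `f'` of the derived algebra
    (e : Fin a → 𝔤) (f' : Fin b → 𝔤)
    (he : Submodule.span 𝔬
      (Set.range fun i => (LieAlgebra.center 𝔬 𝔤).toSubmodule.mkQ (e i)) = ⊤)
    (hf' : Submodule.span 𝔬 (Set.range f') =
      (lieDerived 𝔬 𝔤).toSubmodule)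
    -- structure constants
    (lam : Fin a → Fin a → Fin b → 𝔬)
    (hlam : ∀ i j, ⁅e i, e j⁆ = ∑ k, lam i j k • f' k)
    (hlam_skew : ∀ i j k, lam i j k = -lam j i k)
    -- the hypotheses on the ranks of `B(y)`
    (ha2 : 2 < a)
    (hranks : Set.range (fun y : ℙ (IsLocalRing.ResidueField 𝔬)
      (Fin b → IsLocalRing.ResidueField 𝔬) => commutatorRank lam y) = {a - 2, a})
    (hlines : ∀ L : Projectivization.Subspace (IsLocalRing.ResidueField 𝔬)
        (Fin b → IsLocalRing.ResidueField 𝔬),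
      Module.finrank (IsLocalRing.ResidueField 𝔬) (Projectivization.Subspace.submodule L) = 2 →
        ∃ y ∈ L, commutatorRank lam y = a)
    (n : ℕ)
    (hn : n = Nat.card {y : ℙ (IsLocalRing.ResidueField 𝔬)
      (Fin b → IsLocalRing.ResidueField 𝔬) // commutatorRank lam y = a - 2}) :
    Even a ∧ 1 < b ∧
    -- the class vector of `G = exp(𝔤)`
    (∀ i : ℕ, (classVector p (LazardExp 𝔬 𝔤 hclass) (i * f) : ℚ) =
      if i = 0 then (Nat.card (Subgroup.center (LazardExp 𝔬 𝔤 hclass)) : ℚ)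
      else if i = b - 1 then
        (Nat.card (Subgroup.center (LazardExp 𝔬 𝔤 hclass)) : ℚ) *
          (q : ℚ) ^ (-(b : ℤ) + 1) * n * ((q : ℚ) ^ 2 - 1)
      else if i = b then
        (Nat.card (Subgroup.center (LazardExp 𝔬 𝔤 hclass)) : ℚ) *
          (q : ℚ) ^ (-(b : ℤ)) * ((q : ℚ) ^ a - 1 - n * ((q : ℚ) ^ 2 - 1))
      else 0) ∧
    (∀ j : ℕ, ¬ f ∣ j → classVector p (LazardExp 𝔬 𝔤 hclass) j = 0) ∧
    -- the character vector of `G`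
    (∀ i : ℕ, (characterVector p (LazardExp 𝔬 𝔤 hclass) (i * f) : ℚ) =
      if i = 0 then
        (Nat.card (LazardExp 𝔬 𝔤 hclass ⧸ commutator (LazardExp 𝔬 𝔤 hclass)) : ℚ)
      else if i = a / 2 - 1 then
        (Nat.card (LazardExp 𝔬 𝔤 hclass ⧸ commutator (LazardExp 𝔬 𝔤 hclass)) : ℚ) *
          (q : ℚ) ^ (-(a : ℤ) + 2) * n * ((q : ℚ) - 1)
      else if i = a / 2 then
        (Nat.card (LazardExp 𝔬 𝔤 hclass ⧸ commutator (LazardExp 𝔬 𝔤 hclass)) : ℚ) *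
          (q : ℚ) ^ (-(a : ℤ)) * ((q : ℚ) ^ b - 1 - n * ((q : ℚ) - 1))
      else 0) ∧
    (∀ j : ℕ, ¬ f ∣ j → characterVector p (LazardExp 𝔬 𝔤 hclass) j = 0) ∧
    -- the class number of `G`
    (classNumber (LazardExp 𝔬 𝔤 hclass) : ℚ) =
      (Nat.card (LazardExp 𝔬 𝔤 hclass) : ℚ) *
        ((q : ℚ) ^ (-(a : ℤ)) + (q : ℚ) ^ (-(b : ℤ)) +
          (q : ℚ) ^ (-(a : ℤ) - (b : ℤ)) *
            (n * ((q : ℚ) ^ 2 - 1) * ((q : ℚ) - 1) - 1)) := by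
  classical
  set K := IsLocalRing.ResidueField 𝔬
  set G := LazardExp 𝔬 𝔤 hclass
  have hodd : Odd q := hqf ▸ (hp.odd_of_ne_two hp2).pow
  have hfin : Finite K := Nat.finite_of_card_ne_zero (hq ▸ hodd.pos.ne')
  have h2 : IsUnit (2 : 𝔬) := IsLocalRing.isUnit_two_of_odd_card (hq.symm ▸ hodd)
  have h2K : (2 : K) ≠ 0 := by
    have := h2.map (algebraMap 𝔬 K)
    rw [map_ofNat] at this
    exact this.ne_zero
  have hq1 : 1 < q := hq ▸ Finite.one_lt_card
  have hQ0 : (q : ℚ) ≠ 0 := Nat.cast_ne_zero.2 (by omega)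
  have hf0 : f ≠ 0 := by
    rintro rfl
    rw [hqf, pow_zero] at hq1
    exact lt_irrefl _ hq1
  obtain ⟨π, κ, hπ, hπker, hκ⟩ :=
    LazardExp.exists_coordinates hcocentre hderived ha hb e f' he hf' lam hlam
  -- The ranks of `B(y)` for vectors `y`.
  have hrank : ∀ y : Fin b → K, y ≠ 0 →
      (commutatorMatrixAt lam y).rank = a - 2 ∨ (commutatorMatrixAt lam y).rank = a := by
    intro y hy
    have : commutatorRank lam (Projectivization.mk K y hy) ∈ ({a - 2, a} : Set ℕ) :=
      hranks ▸ ⟨_, rfl⟩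
    exact this
  obtain ⟨y₁, hy₁⟩ : ∃ y, commutatorRank lam y = a - 2 := by
    have h3 : a - 2 ∈ ({a - 2, a} : Set ℕ) := Or.inl rfl
    rw [← hranks] at h3
    exact h3
  obtain ⟨y₂, hy₂⟩ : ∃ y, commutatorRank lam y = a := by
    have h3 : a ∈ ({a - 2, a} : Set ℕ) := Or.inr rfl
    rw [← hranks] at h3
    exact h3
  have heven : Even a := by
    induction y₂ using Projectivization.ind with
    | h v hv => exact even_of_rank_commutatorMatrixAt_eq lam h2K hlam_skew v hy₂
  -- The projective space has two distinct points.
  have hb1 : 1 < b := by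
    by_contra hb1
    have hne : y₁ ≠ y₂ := by
      rintro rfl
      omega
    apply hne
    induction y₁ using Projectivization.ind with
    | h v hv =>
      induction y₂ using Projectivization.ind with
      | h w hw =>
        rw [Projectivization.mk_eq_mk_iff']
        have hle : Module.finrank K (Fin b → K) ≤ 1 := by
          rw [Module.finrank_fin_fun]
          omega
        obtain ⟨u, hu⟩ := finrank_le_one_iff.1 hle
        obtain ⟨s, rfl⟩ := hu v
        obtain ⟨t, rfl⟩ := hu w
        have ht : t ≠ 0 := fun h0 => hw (by rw [h0, zero_smul])
        exact ⟨s / t, by rw [smul_smul, div_mul_cancel₀ _ ht]⟩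
  have hcardB : Nat.card {y : Fin b → K // (commutatorMatrixAt lam y).rank = a - 2}
      = n * (q - 1) := by
    rw [card_rank_eq_card_commutatorRank_mul lam (by omega), hn, hq]
  have hadj : ∀ c : Fin a → K, c ≠ 0 → b ≤ (adjointMatrixAt lam c).rank + 1 :=
    fun c hc => le_rank_adjointMatrixAt_add_one lam hlines hc
  have hadj' : ∀ c : Fin a → K, c ≠ 0 →
      (adjointMatrixAt lam c).rank = b - 1 ∨ (adjointMatrixAt lam c).rank = b := by
    intro c hc
    have h3 := hadj c hc
    have h4 : (adjointMatrixAt lam c).rank ≤ b := by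
      simpa using (adjointMatrixAt lam c).rank_le_card_height
    omega
  have hcardA : Nat.card {c : Fin a → K // (adjointMatrixAt lam c).rank = b - 1}
      = n * (q ^ 2 - 1) := by
    rw [card_rank_adjointMatrixAt_eq lam ha2 hb1 hrank hadj n (by rw [hcardB, hq]), hq]
  have hA := card_fibers_of_two_values (0 : Fin a → K) (fun c => (adjointMatrixAt lam c).rank)
    (b - 1) b _ (by rw [adjointMatrixAt_zero, Matrix.rank_zero]) hadj' (by omega) (by omega) hcardA
  have hB := card_fibers_of_two_values (0 : Fin b → K) (fun y => (commutatorMatrixAt lam y).rank)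
    (a - 2) a _ (by rw [commutatorMatrixAt_zero, Matrix.rank_zero]) hrank (by omega) (by omega)
    hcardB
  rw [Nat.card_fun, Nat.card_fin, hq] at hA hB
  push_cast [hq1.le, Nat.one_le_pow 2 q (by omega)] at hA hB
  have hclassSize : ∀ j, classVector p G j * p ^ j
      = Nat.card {c : Fin a → K // q ^ (adjointMatrixAt lam c).rank = p ^ j}
        * Nat.card (Subgroup.center G) := by
    intro j
    rw [LazardExp.classVector_mul_pow_eq h2 hπ hπker hκ p j, hq]
  have hcharSize : ∀ j, characterVector p G j * p ^ (2 * j)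
      = Nat.card {y : Fin b → K // q ^ (commutatorMatrixAt lam y).rank = p ^ (2 * j)}
        * Nat.card (G ⧸ commutator G) := by
    intro j
    rw [LazardExp.characterVector_mul_pow_eq h2 hπ hκ hp.pos j, hq]
  have hpq : ∀ r j, q ^ r = p ^ j ↔ f * r = j := fun r j => by
    rw [hqf, ← pow_mul, Nat.pow_right_inj hp.two_le]
  have hqq : ∀ i, (p : ℚ) ^ (i * f) = (q : ℚ) ^ i := fun i => by
    rw [hqf, Nat.cast_pow, ← pow_mul, mul_comm]
  have hcv : ∀ i, (classVector p G (i * f) : ℚ)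
      = Nat.card {c : Fin a → K // (adjointMatrixAt lam c).rank = i}
        * Nat.card (Subgroup.center G) / (q : ℚ) ^ i := by
    intro i
    rw [eq_div_iff (pow_ne_zero _ hQ0), ← hqq]
    have h3 : ∀ r, q ^ r = p ^ (i * f) ↔ r = i := fun r => by
      rw [hpq, mul_comm i, Nat.mul_right_inj hf0]
    have h4 := hclassSize (i * f)
    simp only [h3] at h4
    exact_mod_cast h4
  have hch : ∀ i, (characterVector p G (i * f) : ℚ)
      = Nat.card {y : Fin b → K // (commutatorMatrixAt lam y).rank = 2 * i}
        * Nat.card (G ⧸ commutator G) / (q : ℚ) ^ (2 * i) := by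
    intro i
    rw [eq_div_iff (pow_ne_zero _ hQ0), ← hqq]
    have h3 : ∀ r, q ^ r = p ^ (2 * (i * f)) ↔ r = 2 * i := fun r => by
      rw [hpq, ← mul_assoc, mul_comm (2 * i), Nat.mul_right_inj hf0]
    have h4 := hcharSize (i * f)
    simp only [h3] at h4
    rw [mul_assoc]
    exact_mod_cast h4
  have hzpow : ∀ (z : ℤ) (m : ℕ), z = -(m : ℤ) → (q : ℚ) ^ z = ((q : ℚ) ^ m)⁻¹ := by
    rintro z m rfl
    rw [zpow_neg, zpow_natCast]
  have hclassVector : ∀ i : ℕ, (classVector p G (i * f) : ℚ) =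
      if i = 0 then (Nat.card (Subgroup.center G) : ℚ)
      else if i = b - 1 then
        (Nat.card (Subgroup.center G) : ℚ) * (q : ℚ) ^ (-(b : ℤ) + 1) * n * ((q : ℚ) ^ 2 - 1)
      else if i = b then
        (Nat.card (Subgroup.center G) : ℚ) *
          (q : ℚ) ^ (-(b : ℤ)) * ((q : ℚ) ^ a - 1 - n * ((q : ℚ) ^ 2 - 1))
      else 0 := by
    intro i
    rw [hcv, hA, hzpow (-(b : ℤ) + 1) (b - 1) (by omega), hzpow (-(b : ℤ)) b rfl]
    split_ifs with h3 h4 h5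
    · rw [h3, pow_zero, one_mul, div_one]
    · rw [h4]
      ring
    · rw [h5]
      ring
    · rw [zero_mul, zero_div]
  refine ⟨heven, hb1, hclassVector, ?_, ?_, ?_, ?_⟩
  · intro j hj
    have h3 := hclassSize j
    have h4 : IsEmpty {c : Fin a → K // q ^ (adjointMatrixAt lam c).rank = p ^ j} :=
      ⟨fun c => hj ⟨_, ((hpq _ _).1 c.2).symm⟩⟩
    rw [Nat.card_of_isEmpty, zero_mul] at h3
    exact (mul_eq_zero.1 h3).resolve_right (pow_ne_zero _ hp.ne_zero)
  · intro i
    obtain ⟨m, hm⟩ := heven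
    rw [hch, hB, hzpow (-(a : ℤ) + 2) (a - 2) (by omega), hzpow (-(a : ℤ)) a rfl]
    have e0 : 2 * i = 0 ↔ i = 0 := by omega
    have e1 : 2 * i = a - 2 ↔ i = a / 2 - 1 := by omega
    have e2 : 2 * i = a ↔ i = a / 2 := by omega
    simp only [e0, e1, e2]
    split_ifs with h3 h4 h5
    · rw [h3, mul_zero, pow_zero, one_mul, div_one]
    · rw [e1.2 h4]
      ring
    · rw [e2.2 h5]
      ring
    · rw [zero_mul, zero_div]
  · intro j hj
    have h3 := hcharSize j
    have h4 : IsEmpty {y : Fin b → K // q ^ (commutatorMatrixAt lam y).rank = p ^ (2 * j)} := by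
      refine ⟨fun y => hj ?_⟩
      have h5 := (hpq _ _).1 y.2
      -- All ranks of `B(y)` are even.
      have h6 : ∃ r, (commutatorMatrixAt lam y.1).rank = 2 * r := by
        obtain ⟨m, hm⟩ := heven
        by_cases hy : y.1 = 0
        · exact ⟨0, by rw [hy, commutatorMatrixAt_zero, Matrix.rank_zero]⟩
        · rcases hrank y.1 hy with h | h
          · exact ⟨m - 1, by omega⟩
          · exact ⟨m, by omega⟩
      obtain ⟨r, hr⟩ := h6
      refine ⟨r, ?_⟩
      rw [hr] at h5
      apply Nat.eq_of_mul_eq_mul_left two_pos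
      rw [← h5]
      ring
    rw [Nat.card_of_isEmpty, zero_mul] at h3
    exact (mul_eq_zero.1 h3).resolve_right (pow_ne_zero _ hp.ne_zero)
  · have hsize : ∀ C : ConjClasses G, Nat.card C.carrier = p ^ (0 * f) ∨
        Nat.card C.carrier = p ^ ((b - 1) * f) ∨ Nat.card C.carrier = p ^ (b * f) := by
      intro C
      obtain ⟨g, rfl⟩ := ConjClasses.exists_rep C
      have h3 := (LazardExp.card_carrier_mk h2 g).trans (LazardExp.card_range_lie hπ hκ g.log)
      rw [hq] at h3
      have h4 : ∀ r, q ^ r = p ^ (r * f) := fun r => by rw [hqf, ← pow_mul, mul_comm]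
      rw [h3, ← h4, ← h4, ← h4]
      by_cases hg : π g.log = 0
      · left
        rw [hg, adjointMatrixAt_zero, Matrix.rank_zero]
      · rcases hadj' _ hg with h | h
        · exact Or.inr (Or.inl (by rw [h]))
        · exact Or.inr (Or.inr (by rw [h]))
    have hne : ∀ i j, i ≠ j → p ^ (i * f) ≠ p ^ (j * f) := fun i j hij he =>
      hij (Nat.eq_of_mul_eq_mul_right (Nat.pos_of_ne_zero hf0)
        (Nat.pow_right_injective hp.two_le he))
    have hk : classNumber G
        = classVector p G (0 * f) + classVector p G ((b - 1) * f) + classVector p G (b * f) :=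
      card_eq_add_of_three_values (fun C : ConjClasses G => Nat.card C.carrier) _ _ _
        (hne _ _ (by omega)) (hne _ _ (by omega)) (hne _ _ (by omega)) hsize
    have hG : (Nat.card G : ℚ) = (q : ℚ) ^ a * Nat.card (Subgroup.center G) := by
      have h3 := LazardExp.card_eq_card_ker_mul hπ
      rw [hπker, hq] at h3
      have h4 : Nat.card G = q ^ a * Nat.card (Subgroup.center G) := by
        rw [LazardExp.card_center h2]
        exact (Nat.card_congr (LazardExp.logEquiv 𝔬 hclass)).trans h3
      exact_mod_cast h4
    have hb0 : b ≠ 0 := by omega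
    have hb2 : b - 1 ≠ 0 := by omega
    have hb3 : b ≠ b - 1 := by omega
    rw [hk]
    push_cast
    rw [hclassVector, hclassVector, hclassVector, if_pos rfl, if_neg hb2, if_pos rfl, if_neg hb0,
      if_neg hb3, if_pos rfl, hG, zpow_add₀ hQ0, zpow_sub₀ hQ0, zpow_neg, zpow_neg, zpow_natCast,
      zpow_natCast, zpow_one]
    field_simp
    ring
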